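/- Let $G$ and $H$ be second countable, locally compact Hausdorff (topological) groupoids, with unit spaces $G^{(0)}$, $H^{(0)}$ and range and source maps $r,s$. Suppose that $G$ and $H$ are equivalent, i.e. that there is a locally compact Hausdorff space $Z$ with * a free and proper continuous left action of $G$ with open moment map $r_Z\colon Z\to G^{(0)}$, and a free and proper continuous right action of $H$ with open moment map $s_Z\colon Z\to H^{(0)}$ (an action of $G$ on $Z$ is free if $g\cdot z=z$ holds only for units $g$, and proper if $(g,z)\mapsto(g\cdot z,z)$ is a proper map from $\{(g,z)\in G\times Z: s(g)=r_Z(z)\}$ to $Z\times Z$; similarly for $H$), * such that the two actions commute, $r_Z$ induces a bijection of $Z/H$ onto $G^{(0)}$, and $s_Z$ induces a bijection of $G\backslash Z$ onto $H^{(0)}$. If $G$ has a Haar system, then $H$ has a Haar system. Here a Haar system on $G$ is a family $\{\lambda^u\}_{u\in G^{(0)}}$ of Radon measures on $G$ such that $\operatorname{supp}\lambda^u=\{x\in G: r(x)=u\}$ for all $u$; the function $u\mapsto\int_G f\,d\lambda^u$ is continuous on $G^{(0)}$ for every $f\in C_c(G)$; and $\lambda^{s(x)}(x^{-1}E)=\lambda^{r(x)}(E)$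 for every $x\in G$ and every Borel set $E\subset G$, where $x^{-1}E=\{y\in G: s(x)=r(y),\ xy\in E\}$. -/

import Mathlib

open MeasureTheory Topology

/-- A topological groupoid with space of arrows `G` and unit space `X`.
The product `x y` is defined exactly when `s x = r y`.
Since `unit` is a continuous section of `r`, it identifies `X` homeomorphically with the
subspace of units of `G`. -/
structure TopGroupoid (G X : Type*) [TopologicalSpace G] [TopologicalSpace X] where
  /-- the range map -/
  r : G → X
  /-- the source map -/
  s : G → X
  /-- the inclusion of the units -/
  unit : X → G
  /-- the inversion -/
  inv : G → G
  /-- the product of composable arrows -/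
  mul : (x y : G) → s x = r y → G
  r_unit : ∀ u, r (unit u) = u
  s_unit : ∀ u, s (unit u) = u
  r_inv : ∀ x, r (inv x) = s x
  s_inv : ∀ x, s (inv x) = r x
  r_mul : ∀ x y (h : s x = r y), r (mul x y h) = r x
  s_mul : ∀ x y (h : s x = r y), s (mul x y h) = s y
  mul_assoc : ∀ x y z (hxy : s x = r y) (hyz : s y = r z),
    mul (mul x y hxy) z ((s_mul x y hxy).trans hyz) =
      mul x (mul y z hyz) (hxy.trans (r_mul y z hyz).symm)
  unit_mul : ∀ x, mul (unit (r x)) x (s_unit (r x)) = x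
  mul_unit : ∀ x, mul x (unit (s x)) (r_unit (s x)).symm = x
  inv_mul : ∀ x, mul (inv x) x (s_inv x) = unit (s x)
  mul_inv : ∀ x, mul x (inv x) (r_inv x).symm = unit (r x)
  continuous_r : Continuous r
  continuous_s : Continuous s
  continuous_unit : Continuous unit
  continuous_inv : Continuous inv
  continuous_mul : Continuous fun p : {p : G × G // s p.1 = r p.2} => mul p.1.1 p.1.2 p.2

/-- A (continuous) Haar system on a topological groupoid: a family of Radon measures
`measure u` on `G`, `u ∈ X`, with support `r⁻¹(u)`, which is continuous and left invariant. -/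
structure HaarSystem {G X : Type*} [TopologicalSpace G] [TopologicalSpace X]
    [MeasurableSpace G] [BorelSpace G] (𝒢 : TopGroupoid G X) where
  /-- the measures of the system -/
  measure : X → Measure G
  regular : ∀ u, (measure u).Regular
  support_eq : ∀ u, (measure u).support = {x | 𝒢.r x = u}
  continuous_integral : ∀ f : G → ℂ, Continuous f → HasCompactSupport f →
    Continuous fun u => ∫ x, f x ∂(measure u)
  /-- `λ^{s(x)}(x⁻¹ E) = λ^{r(x)}(E)`, where `x⁻¹ E` is the set of all `y` such that
  the product `x y` is defined and belongs to `E` -/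
  left_invariant : ∀ (x : G) (E : Set G), MeasurableSet E →
    measure (𝒢.s x) {y | ∃ h : 𝒢.s x = 𝒢.r y, 𝒢.mul x y h ∈ E} = measure (𝒢.r x) E

/-- A continuous left action of a topological groupoid on a space `Z`, with moment map
`moment : Z → X`; `g • z` is defined exactly when `s g = moment z`. -/
structure LeftAction {G X : Type*} [TopologicalSpace G] [TopologicalSpace X]
    (𝒢 : TopGroupoid G X) (Z : Type*) [TopologicalSpace Z] where
  /-- the moment map -/
  moment : Z → X
  /-- the action -/
  act : (g : G) → (z : Z) → 𝒢.s g = moment z → Z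
  moment_act : ∀ g z (h : 𝒢.s g = moment z), moment (act g z h) = 𝒢.r g
  unit_act : ∀ z, act (𝒢.unit (moment z)) z (𝒢.s_unit (moment z)) = z
  mul_act : ∀ g k z (hgk : 𝒢.s g = 𝒢.r k) (hk : 𝒢.s k = moment z),
    act (𝒢.mul g k hgk) z ((𝒢.s_mul g k hgk).trans hk) =
      act g (act k z hk) (hgk.trans (moment_act k z hk).symm)
  continuous_moment : Continuous moment
  continuous_act :
    Continuous fun p : {p : G × Z // 𝒢.s p.1 = moment p.2} => act p.1.1 p.1.2 p.2

/-- A continuous right action of a topological groupoid on a space `Z`, with moment map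
`moment : Z → Y`; `z • h` is defined exactly when `moment z = r h`. -/
structure RightAction {H Y : Type*} [TopologicalSpace H] [TopologicalSpace Y]
    (ℋ : TopGroupoid H Y) (Z : Type*) [TopologicalSpace Z] where
  /-- the moment map -/
  moment : Z → Y
  /-- the action -/
  act : (z : Z) → (h : H) → moment z = ℋ.r h → Z
  moment_act : ∀ z h (e : moment z = ℋ.r h), moment (act z h e) = ℋ.s h
  act_unit : ∀ z, act z (ℋ.unit (moment z)) (ℋ.r_unit (moment z)).symm = z
  act_mul : ∀ z h k (hz : moment z = ℋ.r h) (hhk : ℋ.s h = ℋ.r k),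
    act z (ℋ.mul h k hhk) (hz.trans (ℋ.r_mul h k hhk).symm) =
      act (act z h hz) k ((moment_act z h hz).trans hhk)
  continuous_moment : Continuous moment
  continuous_act :
    Continuous fun p : {p : Z × H // moment p.1 = ℋ.r p.2} => act p.1.1 p.1.2 p.2

/-- A left action is free if only units fix points. -/
def LeftAction.IsFree {G X Z : Type*} [TopologicalSpace G] [TopologicalSpace X]
    [TopologicalSpace Z] {𝒢 : TopGroupoid G X} (A : LeftAction 𝒢 Z) : Prop :=
  ∀ g z (h : 𝒢.s g = A.moment z), A.act g z h = z → g = 𝒢.unit (A.moment z)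

/-- A left action is proper if `(g, z) ↦ (g • z, z)` is a proper map into `Z × Z`. -/
def LeftAction.IsProper {G X Z : Type*} [TopologicalSpace G] [TopologicalSpace X]
    [TopologicalSpace Z] {𝒢 : TopGroupoid G X} (A : LeftAction 𝒢 Z) : Prop :=
  IsProperMap fun p : {p : G × Z // 𝒢.s p.1 = A.moment p.2} =>
    (A.act p.1.1 p.1.2 p.2, p.1.2)

/-- A right action is free if only units fix points. -/
def RightAction.IsFree {H Y Z : Type*} [TopologicalSpace H] [TopologicalSpace Y]
    [TopologicalSpace Z] {ℋ : TopGroupoid H Y} (B : RightAction ℋ Z) : Prop :=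
  ∀ z h (e : B.moment z = ℋ.r h), B.act z h e = z → h = ℋ.unit (B.moment z)

/-- A right action is proper if `(z, h) ↦ (z, z • h)` is a proper map into `Z × Z`. -/
def RightAction.IsProper {H Y Z : Type*} [TopologicalSpace H] [TopologicalSpace Y]
    [TopologicalSpace Z] {ℋ : TopGroupoid H Y} (B : RightAction ℋ Z) : Prop :=
  IsProperMap fun p : {p : Z × H // B.moment p.1 = ℋ.r p.2} =>
    (p.1.1, B.act p.1.1 p.1.2 p.2)

/-- A `(𝒢, ℋ)`-equivalence: a locally compact Hausdorff space `Z` with commuting free and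
proper actions of `𝒢` on the left and of `ℋ` on the right, with open moment maps
`r_Z : Z → X` and `s_Z : Z → Y` that induce bijections `Z/ℋ → X` and `𝒢\Z → Y`. -/
structure GroupoidEquivalence {G X H Y : Type*} [TopologicalSpace G] [TopologicalSpace X]
    [TopologicalSpace H] [TopologicalSpace Y] (𝒢 : TopGroupoid G X) (ℋ : TopGroupoid H Y)
    (Z : Type*) [TopologicalSpace Z] [LocallyCompactSpace Z] [T2Space Z] where
  /-- the left action, with moment map `r_Z` -/
  left : LeftAction 𝒢 Z
  /-- the right action, with moment map `s_Z` -/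
  right : RightAction ℋ Z
  left_free : left.IsFree
  left_proper : left.IsProper
  left_open : IsOpenMap left.moment
  right_free : right.IsFree
  right_proper : right.IsProper
  right_open : IsOpenMap right.moment
  /-- the map `r_Z` is constant on the orbits of the right action -/
  left_moment_act : ∀ z h (e : right.moment z = ℋ.r h),
    left.moment (right.act z h e) = left.moment z
  /-- the map `s_Z` is constant on the orbits of the left action -/
  right_moment_act : ∀ g z (e : 𝒢.s g = left.moment z),
    right.moment (left.act g z e) = right.moment z
  /-- the actions commute -/
  act_comm : ∀ g z h (e : 𝒢.s g = left.moment z) (e' : right.moment z = ℋ.r h),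
    right.act (left.act g z e) h ((right_moment_act g z e).trans e') =
      left.act g (right.act z h e') (e.trans (left_moment_act z h e').symm)
  /-- the map `Z/ℋ → X` induced by `r_Z` is surjective -/
  left_surjective : Function.Surjective left.moment
  /-- the map `Z/ℋ → X` induced by `r_Z` is injective -/
  left_injective : ∀ z w, left.moment z = left.moment w →
    ∃ (h : H) (e : right.moment z = ℋ.r h), right.act z h e = w
  /-- the map `𝒢\Z → Y` induced by `s_Z` is surjective -/
  right_surjective : Function.Surjective right.moment
  /-- the map `𝒢\Z → Y` induced by `s_Z` is injective -/
  right_injective : ∀ z w, right.moment z = right.moment w →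
    ∃ (g : G) (e : 𝒢.s g = left.moment z), left.act g z e = w

/-!
Let `𝒢` and `ℋ` be equivalent through `Z`, with moment maps `r_Z : Z → X` and `s_Z : Z → Y`. For
points `y`, `w` in one fibre of `r_Z` there is exactly one arrow `[y, w]` of `ℋ` with
`y • [y, w] = w`, and it depends continuously on `(y, w)` because the right action is free and proper
(`RightAction.continuousOn_arrow`). Given measures `β x` on the fibres of `r_Z`, every `f ∈ C_c(ℋ)`
yields a function `Φ_f(y) = ∫ f [y, w] dβ^{r_Z(y)}(w)` on `Z`, with compact support if the `β x` live on
a common compact set. Integration over the `𝒢`-orbit of `z` gives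
`T_f(z) = ∫ Φ_f(g⁻¹ • z) dλ^{r_Z(z)}(g)`. By left invariance of `λ`, this depends only on `s_Z(z)`,
hence is a function on `Y`. As the two actions commute and `[y, w] = k [y • k, w]`,
`f ↦ T_f` is left invariant under `ℋ`, whatever `β` is (`GroupoidEquivalence.transfer_right_act`).
So it remains to find enough continuous families `β`, to add up the functionals so obtained, and to
apply the Riesz–Markov–Kakutani theorem.

A continuous family `β` that lives on the closure of a given relatively compact open set `V` and is
nonzero over `r_Z(V)` exists because `r_Z` is open (`exists_isContinuousSystem`). Cover `V` by finitely
many small balls and distribute the mass over `x` among the pieces `W` of `V` in proportion to a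
continuous function of `x` that is positive exactly on the open set `r_Z(W)`. Repeat this with smaller
and smaller balls. Placing the mass of each piece at a sample point, one gets functionals that
converge uniformly on each `f ∈ C_c(Z)`, to functionals concentrated on the fibres. This uses a metric
on `Z`, so `Z` must be second countable. That follows from the equivalence: `Z` is `σ`-compact with a
`G_δ` diagonal (`GroupoidEquivalence.secondCountableTopology`).

With `V` running through a countable base, the functionals `T` see every arrow of `ℋ`. Small positive
factors make their sum converge on all of `C_c(ℋ)`, uniformly on `Y`
(`exists_isInvariantFunctional_tsum`), and the sum is an invariant family with full support, that is,
a Haar system (`IsInvariantFunctional.nonempty_haarSystem`).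
-/

set_option linter.unusedSectionVars false

/-! ### Radon measures and continuous systems -/

section Functional

variable {W : Type*} [TopologicalSpace W] [T2Space W] [LocallyCompactSpace W]
  [MeasurableSpace W] [BorelSpace W]

open CompactlySupported in
/-- The Riesz–Markov–Kakutani theorem for a functional that is given on all functions, but is
linear and positive only on the continuous ones with compact support. -/
theorem exists_regular_measure_of_functional (L : (W → ℝ) → ℝ)
    (hadd : ∀ f g : W → ℝ, Continuous f → HasCompactSupport f → Continuous g →
      HasCompactSupport g → L (f + g) = L f + L g)
    (hsmul : ∀ (c : ℝ) (f : W → ℝ), Continuous f → HasCompactSupport f → L (c • f) = c * L f)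
    (hpos : ∀ f : W → ℝ, Continuous f → HasCompactSupport f → (∀ w, 0 ≤ f w) → 0 ≤ L f) :
    ∃ μ : Measure W, μ.Regular ∧
      ∀ f : W → ℝ, Continuous f → HasCompactSupport f → ∫ w, f w ∂μ = L f := by
  let l : C_c(W, ℝ) →ₗ[ℝ] ℝ :=
    { toFun := fun f => L f
      map_add' := fun f g =>
        hadd f g f.continuous f.hasCompactSupport g.continuous g.hasCompactSupport
      map_smul' := fun c f => hsmul c f f.continuous f.hasCompactSupport }
  let Λ : C_c(W, ℝ) →ₚ[ℝ] ℝ :=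
    { l with
      monotone' := fun f g hfg => by
        have h := hpos (g - f : C_c(W, ℝ)) (g - f).continuous (g - f).hasCompactSupport
          fun w => sub_nonneg.2 (hfg w)
        have h' : l (g - f) = l g - l f := map_sub l g f
        have : 0 ≤ l (g - f) := h
        change l f ≤ l g
        linarith }
  refine ⟨RealRMK.rieszMeasure Λ, inferInstance, fun f hf hf' => ?_⟩
  exact RealRMK.integral_rieszMeasure Λ ⟨⟨f, hf⟩, hf'⟩

/-- A regular measure that annihilates all `f ∈ C_c` vanishing off an open set is zero there. -/
theorem measure_eq_zero_of_integral_eq_zero {μ : Measure W} [μ.Regular] {O : Set W}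
    (hO : IsOpen O)
    (h : ∀ f : W → ℝ, Continuous f → HasCompactSupport f → (∀ w, 0 ≤ f w) →
      (∀ w ∉ O, f w = 0) → ∫ w, f w ∂μ = 0) : μ O = 0 := by
  rw [hO.measure_eq_iSup_isCompact]
  simp only [ENNReal.iSup_eq_zero]
  intro K hKO hK
  obtain ⟨f, hf1, hf0, hfc, hf⟩ := exists_continuous_one_zero_of_isCompact hK hO.isClosed_compl
    (Set.disjoint_compl_right_iff_subset.2 hKO)
  have h0 := h f f.continuous hfc (fun w => (hf w).1) (fun w hw => hf0 hw)
  have hint : Integrable f μ := f.continuous.integrable_of_hasCompactSupport hfc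
  rw [integral_eq_zero_iff_of_nonneg (fun w => (hf w).1) hint] at h0
  refine measure_mono_null (fun w hw => ?_) (ae_iff.1 h0)
  simp [hf1 hw]

theorem integral_pos_of_mem_support {μ : Measure W} {f : W → ℝ} (hf : ∀ w, 0 ≤ f w)
    (hint : Integrable f μ) {w : W} (hw : w ∈ μ.support) {S : Set W} (hS : μ Sᶜ = 0)
    (hpos : ∀ᶠ w' in 𝓝[S] w, 0 < f w') : 0 < ∫ w, f w ∂μ := by
  rw [integral_pos_iff_support_of_nonneg hf hint]
  rw [eventually_nhdsWithin_iff] at hpos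
  have h := (Measure.mem_support_iff_forall w).1 hw _ hpos
  refine h.trans_le ?_
  rw [← measure_inter_conull (t := S) (s := {x | x ∈ S → 0 < f x})]
  · exact measure_mono fun x hx => (hx.1 hx.2).ne'
  · exact hS

end Functional

/-- A continuous system of measures for `p : W → X`: a family of Radon measures `μ x`
concentrated on the fibres `p⁻¹(x)` whose integrals of a fixed continuous function with compact
support depend continuously on `x`. The measures may vanish. -/
structure IsContinuousSystem {W X : Type*} [TopologicalSpace W] [MeasurableSpace W] [BorelSpace W]
    [TopologicalSpace X] (p : W → X) (μ : X → Measure W) : Prop where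
  regular : ∀ x, (μ x).Regular
  fibre : ∀ x, μ x {w | p w = x}ᶜ = 0
  continuous_integral : ∀ f : W → ℝ, Continuous f → HasCompactSupport f →
    Continuous fun x => ∫ w, f w ∂(μ x)

section Param

variable {W X Z : Type*} [TopologicalSpace W] [T2Space W] [LocallyCompactSpace W]
  [SecondCountableTopology W] [MeasurableSpace W] [BorelSpace W] [TopologicalSpace X] [T2Space X]
  [TopologicalSpace Z] [T2Space Z] [LocallyCompactSpace Z] [SecondCountableTopology Z]

/-- A function `F` that is continuous on the fibre product `Z ×_X W`, and vanishes there off one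
compact set for all `z` near `z₀`, is locally the restriction of `(z, w) ↦ F' (z, w) * χ w` for a
continuous function `F'` on the product and a cutoff function `χ`. -/
theorem IsContinuousSystem.exists_eventually_ae_eq {p : W → X} {μ : X → Measure W}
    (hμ : IsContinuousSystem p μ) (hp : Continuous p) {q : Z → X} (hq : Continuous q)
    {F : Z → W → ℝ} (hF : ContinuousOn (fun a : Z × W => F a.1 a.2) {a | q a.1 = p a.2})
    {z₀ : Z} {S : Set W} (hS : IsCompact S)
    (hFS : ∀ᶠ z in 𝓝 z₀, ∀ᵐ w ∂(μ (q z)), w ∉ S → F z w = 0) :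
    ∃ (F' : Z × W → ℝ) (χ : W → ℝ), Continuous F' ∧ Continuous χ ∧ HasCompactSupport χ ∧
      (∀ w, 0 ≤ χ w) ∧
      ∀ᶠ z in 𝓝 z₀, F z =ᵐ[μ (q z)] fun w => F' (z, w) * χ w := by
  have hD : IsClosed {a : Z × W | q a.1 = p a.2} :=
    isClosed_eq (hq.comp continuous_fst) (hp.comp continuous_snd)
  obtain ⟨F', hF'⟩ := ContinuousMap.exists_restrict_eq hD
    ⟨fun a : {a : Z × W | q a.1 = p a.2} => F a.1.1 a.1.2, hF.domRestrict⟩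
  obtain ⟨χ, hχ1, -, hχc, hχ⟩ := exists_continuous_one_zero_of_isCompact hS isClosed_empty
    (Set.disjoint_empty S)
  refine ⟨F', χ, F'.continuous, χ.continuous, hχc, fun w => (hχ w).1, ?_⟩
  filter_upwards [hFS] with z hz
  have h1 : ∀ᵐ w ∂(μ (q z)), p w = q z := ae_iff.2 (hμ.fibre (q z))
  filter_upwards [hz, h1] with w hw hw1
  have h2 : F' (z, w) = F z w := DFunLike.congr_fun hF' ⟨(z, w), hw1.symm⟩
  by_cases hwS : w ∈ S
  · rw [h2, hχ1 hwS]; simp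
  · rw [h2, hw hwS]; simp

theorem IsContinuousSystem.integrable_param {p : W → X} {μ : X → Measure W}
    (hμ : IsContinuousSystem p μ) (hp : Continuous p) {q : Z → X} (hq : Continuous q)
    {F : Z → W → ℝ} (hF : ContinuousOn (fun a : Z × W => F a.1 a.2) {a | q a.1 = p a.2})
    (hFS : ∀ z₀, ∃ S : Set W, IsCompact S ∧
      ∀ᶠ z in 𝓝 z₀, ∀ᵐ w ∂(μ (q z)), w ∉ S → F z w = 0) (z : Z) :
    Integrable (F z) (μ (q z)) := by
  obtain ⟨S, hS, hz⟩ := hFS z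
  obtain ⟨F', χ, hF', hχ, hχc, -, h⟩ := hμ.exists_eventually_ae_eq hp hq hF hS hz
  have := hμ.regular (q z)
  refine Integrable.congr ?_ h.self_of_nhds.symm
  exact Continuous.integrable_of_hasCompactSupport (by fun_prop) hχc.mul_left

/-- A continuous system may be integrated against functions that depend continuously on a
parameter, and are defined on the fibres only. -/
theorem IsContinuousSystem.continuous_integral_param {p : W → X} {μ : X → Measure W}
    (hμ : IsContinuousSystem p μ) (hp : Continuous p) {q : Z → X} (hq : Continuous q)
    {F : Z → W → ℝ} (hF : ContinuousOn (fun a : Z × W => F a.1 a.2) {a | q a.1 = p a.2})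
    (hFS : ∀ z₀, ∃ S : Set W, IsCompact S ∧
      ∀ᶠ z in 𝓝 z₀, ∀ᵐ w ∂(μ (q z)), w ∉ S → F z w = 0) :
    Continuous fun z => ∫ w, F z w ∂(μ (q z)) := by
  rw [continuous_iff_continuousAt]
  intro z₀
  obtain ⟨S, hS, hz⟩ := hFS z₀
  obtain ⟨F', χ, hF', hχ, hχc, hχ0, h⟩ := hμ.exists_eventually_ae_eq hp hq hF hS hz
  have hreg := fun x => hμ.regular x
  have hint : ∀ z x, Integrable (fun w => F' (z, w) * χ w) (μ x) := fun z x =>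
    Continuous.integrable_of_hasCompactSupport (by fun_prop) hχc.mul_left
  have hintχ : ∀ x, Integrable χ (μ x) := fun x => hχ.integrable_of_hasCompactSupport hχc
  suffices ContinuousAt (fun z => ∫ w, F' (z, w) * χ w ∂(μ (q z))) z₀ by
    refine this.congr ?_
    filter_upwards [h] with z hz
    exact (integral_congr_ae hz).symm
  have hc0 : Continuous fun z => ∫ w, F' (z₀, w) * χ w ∂(μ (q z)) :=
    (hμ.continuous_integral _ (by fun_prop) hχc.mul_left).comp hq
  have hcχ : Continuous fun z => ∫ w, χ w ∂(μ (q z)) :=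
    (hμ.continuous_integral _ hχ hχc).comp hq
  rw [Metric.continuousAt_iff']
  intro ε hε
  set C := ∫ w, χ w ∂(μ (q z₀)) + 1 with hC
  have hCpos : 0 < C := by
    have : 0 ≤ ∫ w, χ w ∂(μ (q z₀)) := integral_nonneg hχ0
    linarith
  have hδ : 0 < ε / 2 / C := by positivity
  have e1 : ∀ᶠ z in 𝓝 z₀, ∀ w ∈ tsupport χ, |F' (z, w) - F' (z₀, w)| < ε / 2 / C := by
    refine hχc.isCompact.eventually_forall_of_forall_eventually fun w _ => ?_
    have : ContinuousAt (fun a : Z × W => |F' (a.1, a.2) - F' (z₀, a.2)|) (z₀, w) := by fun_prop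
    exact this.eventually_lt continuousAt_const (by simpa using hδ)
  have e2 : ∀ᶠ z in 𝓝 z₀, ∫ w, χ w ∂(μ (q z)) < C :=
    hcχ.continuousAt.eventually_lt continuousAt_const (by simp [hC])
  have e3 := (Metric.continuousAt_iff'.1 (hc0.continuousAt (x := z₀))) (ε / 2) (half_pos hε)
  filter_upwards [e1, e2, e3] with z h1 h2 h3
  rw [Real.dist_eq] at h3 ⊢
  have key : |∫ w, F' (z, w) * χ w ∂(μ (q z)) - ∫ w, F' (z₀, w) * χ w ∂(μ (q z))| ≤ ε / 2 := by
    rw [← integral_sub (hint _ _) (hint _ _)]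
    calc _ ≤ ∫ w, ε / 2 / C * χ w ∂(μ (q z)) := by
            rw [← Real.norm_eq_abs]
            refine norm_integral_le_of_norm_le ((hintχ _).const_mul _) (.of_forall fun w => ?_)
            rw [← sub_mul, norm_mul, Real.norm_eq_abs, Real.norm_eq_abs, abs_of_nonneg (hχ0 w)]
            by_cases hw : w ∈ tsupport χ
            · exact mul_le_mul_of_nonneg_right (h1 w hw).le (hχ0 w)
            · simp [image_eq_zero_of_notMem_tsupport hw]
      _ = ε / 2 / C * ∫ w, χ w ∂(μ (q z)) := integral_const_mul _ _
      _ ≤ ε / 2 / C * C := mul_le_mul_of_nonneg_left h2.le hδ.le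
      _ = ε / 2 := by field_simp
  have := abs_sub_le (∫ w, F' (z, w) * χ w ∂(μ (q z))) (∫ w, F' (z₀, w) * χ w ∂(μ (q z)))
    (∫ w, F' (z₀, w) * χ w ∂(μ (q z₀)))
  linarith

end Param

/-! ### Second countability, unit spaces and arrows between points of an orbit -/

section Topology

/-- A compact Hausdorff space with a `G_δ` diagonal is second countable: a continuous function
`f` on the square that equals one exactly on the diagonal embeds the space into `C(K, ℝ)` by
`x ↦ f (x, ·)`. -/
theorem secondCountableTopology_of_isGδ_diagonal {K : Type*} [TopologicalSpace K] [CompactSpace K]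
    [T2Space K] (h : IsGδ (Set.diagonal K)) : SecondCountableTopology K := by
  obtain ⟨f, hf, -⟩ := exists_continuous_one_zero_of_isCompact_of_isGδ
    (isClosed_diagonal (X := K)).isCompact h isClosed_empty (Set.disjoint_empty _)
  have hinj : Function.Injective f.curry := by
    intro x y hxy
    have h1 : f (x, x) = 1 := by
      have : (x, x) ∈ f ⁻¹' {1} := hf ▸ Set.mem_diagonal x
      exact this
    have h2 : f (y, x) = 1 := by
      rw [← h1]
      exact (DFunLike.congr_fun hxy x).symm
    have : (y, x) ∈ Set.diagonal K := hf ▸ h2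
    exact (Set.mem_diagonal_iff.1 this).symm
  have hemb : IsClosedEmbedding f.curry := f.curry.continuous.isClosedEmbedding hinj
  have : TopologicalSpace.MetrizableSpace K := hemb.isEmbedding.metrizableSpace
  let := TopologicalSpace.metrizableSpaceMetric K
  infer_instance

theorem secondCountableTopology_of_sigmaCompact_of_isGδ_diagonal {Z : Type*} [TopologicalSpace Z]
    [LocallyCompactSpace Z] [T2Space Z] [SigmaCompactSpace Z] (h : IsGδ (Set.diagonal Z)) :
    SecondCountableTopology Z := by
  let E := CompactExhaustion.choice Z
  have : ∀ n, SecondCountableTopology (interior (E n)) := fun n => by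
    have hc : CompactSpace (E n) := isCompact_iff_compactSpace.1 (E.isCompact n)
    have : SecondCountableTopology (E n) := by
      refine secondCountableTopology_of_isGδ_diagonal ?_
      have hc : Continuous fun p : E n × E n => ((p.1 : Z), (p.2 : Z)) := by fun_prop
      convert h.preimage hc using 1
      ext p
      simp [Subtype.ext_iff]
    exact (Topology.IsEmbedding.inclusion interior_subset).secondCountableTopology
  exact TopologicalSpace.secondCountableTopology_of_countable_cover (fun n => isOpen_interior)
    (Set.iUnion_eq_univ_iff.2 fun z => (E.exists_mem_nhds z).imp fun n h =>
      mem_interior_iff_mem_nhds.2 h)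

/-- A locally compact second countable space has a sequence of relatively compact open sets that
form neighbourhood bases in the strong sense that even their closures are small. -/
theorem exists_seq_isOpen_isCompact_closure (Z : Type*) [TopologicalSpace Z]
    [LocallyCompactSpace Z] [T2Space Z] [SecondCountableTopology Z] :
    ∃ V : ℕ → Set Z, (∀ n, IsOpen (V n)) ∧ (∀ n, IsCompact (closure (V n))) ∧
      ∀ z, ∀ O ∈ 𝓝 z, ∃ n, z ∈ V n ∧ closure (V n) ⊆ O := by
  obtain ⟨b, hbc, -, hb⟩ := TopologicalSpace.exists_countable_basis Z
  have hcount : (insert ∅ {U ∈ b | IsCompact (closure U)}).Countable :=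
    (hbc.mono fun U hU => hU.1).insert ∅
  obtain ⟨V, hV⟩ := hcount.exists_eq_range (Set.insert_nonempty _ _)
  have hmem : ∀ n, V n = ∅ ∨ V n ∈ b ∧ IsCompact (closure (V n)) := fun n => by
    have : V n ∈ insert ∅ {U ∈ b | IsCompact (closure U)} := hV ▸ Set.mem_range_self n
    simpa using this
  refine ⟨V, fun n => ?_, fun n => ?_, fun z O hO => ?_⟩
  · rcases hmem n with h | h
    · simp [h]
    · exact hb.isOpen h.1
  · rcases hmem n with h | h
    · simp [h]
    · exact h.2
  · obtain ⟨K, hKz, hKO, hK⟩ := local_compact_nhds hO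
    obtain ⟨U, hUb, hzU, hUK⟩ := hb.mem_nhds_iff.1 hKz
    have hcl : closure U ⊆ K := closure_minimal hUK hK.isClosed
    have : U ∈ Set.range V := hV ▸ Or.inr ⟨hUb, hK.of_isClosed_subset isClosed_closure hcl⟩
    obtain ⟨n, rfl⟩ := this
    exact ⟨n, hzU, hcl.trans hKO⟩

end Topology

section UnitSpace

variable {G X : Type*} [TopologicalSpace G] [TopologicalSpace X] [T2Space G]

theorem TopGroupoid.isClosedEmbedding_unit (𝒢 : TopGroupoid G X) : IsClosedEmbedding 𝒢.unit := by
  refine ⟨Topology.IsEmbedding.of_leftInverse (f := 𝒢.r) 𝒢.r_unit 𝒢.continuous_r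
    𝒢.continuous_unit, ?_⟩
  have : Set.range 𝒢.unit = {g | 𝒢.unit (𝒢.r g) = g} := by
    ext g
    refine ⟨?_, fun h => ⟨_, h⟩⟩
    rintro ⟨u, rfl⟩
    simp [𝒢.r_unit]
  rw [this]
  exact isClosed_eq (𝒢.continuous_unit.comp 𝒢.continuous_r) continuous_id

theorem TopGroupoid.t2Space_base (𝒢 : TopGroupoid G X) : T2Space X :=
  𝒢.isClosedEmbedding_unit.isEmbedding.t2Space

theorem TopGroupoid.locallyCompactSpace_base [LocallyCompactSpace G] (𝒢 : TopGroupoid G X) :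
    LocallyCompactSpace X :=
  𝒢.isClosedEmbedding_unit.locallyCompactSpace

theorem TopGroupoid.secondCountableTopology_base [SecondCountableTopology G]
    (𝒢 : TopGroupoid G X) : SecondCountableTopology X :=
  𝒢.isClosedEmbedding_unit.isEmbedding.secondCountableTopology

end UnitSpace

section Arrow

variable {H Y Z : Type*} [TopologicalSpace H] [TopologicalSpace Y] [TopologicalSpace Z]
  {ℋ : TopGroupoid H Y}

open Classical in
/-- The arrow `h` with `y • h = z`, for points `y`, `z` of one orbit of a free right action; a
unit if they belong to different orbits. -/
noncomputable def RightAction.arrow (B : RightAction ℋ Z) (y z : Z) : H :=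
  if h : ∃ (h : H) (e : B.moment y = ℋ.r h), B.act y h e = z then h.choose
  else ℋ.unit (B.moment y)

theorem RightAction.arrow_spec (B : RightAction ℋ Z) {y z : Z}
    (h : ∃ (h : H) (e : B.moment y = ℋ.r h), B.act y h e = z) :
    ∃ e : B.moment y = ℋ.r (B.arrow y z), B.act y (B.arrow y z) e = z := by
  rw [RightAction.arrow, dif_pos h]
  exact h.choose_spec

theorem RightAction.IsFree.eq_of_act_eq {B : RightAction ℋ Z} (hB : B.IsFree) {z : Z} {h k : H}
    (eh : B.moment z = ℋ.r h) (ek : B.moment z = ℋ.r k) (he : B.act z h eh = B.act z k ek) :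
    h = k := by
  have hs : ℋ.s h = ℋ.s k := by
    rw [← B.moment_act z h eh, ← B.moment_act z k ek, he]
  -- `z • (h k⁻¹) = z`, hence `h k⁻¹` is a unit
  have e1 : ℋ.s h = ℋ.r (ℋ.inv k) := hs.trans (ℋ.r_inv k).symm
  have e2 : ℋ.s k = ℋ.r (ℋ.inv k) := (ℋ.r_inv k).symm
  have act_congr : ∀ {a b : Z} (c : H) (ea : B.moment a = ℋ.r c) (eb : B.moment b = ℋ.r c),
      a = b → B.act a c ea = B.act b c eb := by
    rintro a b c ea eb rfl; rfl
  have act_congr' : ∀ {a b : H} (ea : B.moment z = ℋ.r a) (eb : B.moment z = ℋ.r b),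
      a = b → B.act z a ea = B.act z b eb := by
    rintro a b ea eb rfl; rfl
  have h1 : B.act z (ℋ.mul h (ℋ.inv k) e1) (eh.trans (ℋ.r_mul _ _ _).symm) = z := by
    rw [B.act_mul z h (ℋ.inv k) eh e1, act_congr _ _ ((B.moment_act z k ek).trans e2) he,
      ← B.act_mul z k (ℋ.inv k) ek e2]
    rw [act_congr' _ (ek.trans (ℋ.r_unit _).symm) (ℋ.mul_inv k), act_congr' _
      (ℋ.r_unit (B.moment z)).symm (by rw [ek]), B.act_unit]
  have h2 := hB _ _ _ h1
  -- multiply `h k⁻¹ = 1` by `k` on the right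
  have mul_congr : ∀ {a b : H} (c : H) (ea : ℋ.s a = ℋ.r c) (eb : ℋ.s b = ℋ.r c),
      a = b → ℋ.mul a c ea = ℋ.mul b c eb := by
    rintro a b c ea eb rfl; rfl
  have mul_congr' : ∀ (a : H) {b c : H} (eb : ℋ.s a = ℋ.r b) (ec : ℋ.s a = ℋ.r c),
      b = c → ℋ.mul a b eb = ℋ.mul a c ec := by
    rintro a b c ea eb rfl; rfl
  have e3 : ℋ.s (ℋ.inv k) = ℋ.r k := ℋ.s_inv k
  have h3 := ℋ.mul_assoc h (ℋ.inv k) k e1 e3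
  rw [mul_congr k _ (ℋ.s_unit _) (h2.trans (by rw [ek])), ℋ.unit_mul,
    mul_congr' h _ ((ℋ.r_unit _).symm) ((ℋ.inv_mul k).trans (by rw [hs])), ℋ.mul_unit] at h3
  exact h3.symm

theorem RightAction.arrow_act {B : RightAction ℋ Z} (hB : B.IsFree) (z : Z) (h : H)
    (e : B.moment z = ℋ.r h) : B.arrow z (B.act z h e) = h := by
  obtain ⟨e', h'⟩ := B.arrow_spec ⟨h, e, rfl⟩
  exact hB.eq_of_act_eq e' e h'

/-- For a free and proper action `(z, h) ↦ (z, z • h)` is a closed embedding, and the arrow between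
two points of an orbit is read off from its inverse. -/
theorem RightAction.continuousOn_arrow {B : RightAction ℋ Z} (hB : B.IsFree) (hP : B.IsProper) :
    ContinuousOn (fun a : Z × Z => B.arrow a.1 a.2)
      {a | ∃ (h : H) (e : B.moment a.1 = ℋ.r h), B.act a.1 h e = a.2} := by
  have hinj : Function.Injective fun p : {p : Z × H // B.moment p.1 = ℋ.r p.2} =>
      (p.1.1, B.act p.1.1 p.1.2 p.2) := by
    rintro ⟨⟨z, h⟩, e⟩ ⟨⟨z', h'⟩, e'⟩ heq
    obtain ⟨h1, h2⟩ := Prod.ext_iff.1 heq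
    dsimp at h1 h2 e e'
    subst h1
    simp only [Subtype.mk.injEq, Prod.mk.injEq, true_and]
    exact hB.eq_of_act_eq e e' h2
  have hemb : IsClosedEmbedding fun p : {p : Z × H // B.moment p.1 = ℋ.r p.2} =>
      (p.1.1, B.act p.1.1 p.1.2 p.2) :=
    .of_continuous_injective_isClosedMap hP.continuous hinj hP.isClosedMap
  rw [continuousOn_iff_continuous_domRestrict]
  let hom := hemb.isEmbedding.toHomeomorph
  have hrange : ∀ a : {a : Z × Z | ∃ (h : H) (e : B.moment a.1 = ℋ.r h), B.act a.1 h e = a.2},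
      (a : Z × Z) ∈ Set.range fun p : {p : Z × H // B.moment p.1 = ℋ.r p.2} =>
        (p.1.1, B.act p.1.1 p.1.2 p.2) := by
    intro a
    obtain ⟨h, e, he⟩ := a.2
    exact ⟨⟨(a.1.1, h), e⟩, Prod.ext rfl he⟩
  have hcont : Continuous fun
      a : {a : Z × Z | ∃ (h : H) (e : B.moment a.1 = ℋ.r h), B.act a.1 h e = a.2} =>
      (hom.symm ⟨a, hrange a⟩).1.2 :=
    continuous_snd.comp (continuous_subtype_val.comp (hom.symm.continuous.comp
      (continuous_subtype_val.subtype_mk _)))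
  convert hcont using 1
  ext a
  obtain ⟨h, e, he⟩ := a.2
  have : hom.symm ⟨a, hrange a⟩ = ⟨(a.1.1, h), e⟩ := by
    rw [Homeomorph.symm_apply_eq]
    exact Subtype.ext (Prod.ext rfl he.symm)
  change B.arrow a.1.1 a.1.2 = _
  rw [this, ← he]
  exact RightAction.arrow_act hB _ h e

end Arrow

/-! ### Continuous systems for open maps -/

section FibreScheme

/-- The data for choosing measures on the fibres of `p : Z → X` over a set `K` by successive
refinement: for each `k` a finite cover of `K` by balls of radius `δ k`, for each open set `V` a
continuous function `mass V` that is positive exactly on `p(V)`, and a point of each nonempty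
set. -/
structure FibreScheme {Z X : Type*} [PseudoMetricSpace Z] [TopologicalSpace X] (p : Z → X)
    (K : Set Z) where
  /-- the weight of an open set, as a function on the base -/
  mass : Set Z → X → ℝ
  /-- a sample point -/
  point : Set Z → Z
  /-- the centres of the balls of generation `k` -/
  centres : ℕ → Finset Z
  /-- the radius of the balls of generation `k` -/
  δ : ℕ → ℝ
  continuous_mass : ∀ V, IsOpen V → Continuous (mass V)
  mass_nonneg : ∀ V x, 0 ≤ mass V x
  mass_le_one : ∀ V x, mass V x ≤ 1
  mass_pos : ∀ V x, IsOpen V → (0 < mass V x ↔ ∃ y ∈ V, p y = x)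
  point_mem : ∀ V, V.Nonempty → point V ∈ V
  cover : ∀ k, ∀ z ∈ K, ∃ j ∈ centres k, z ∈ Metric.ball j (δ k)

namespace FibreScheme

variable {Z X : Type*} [PseudoMetricSpace Z] [TopologicalSpace X] {p : Z → X} {K : Set Z}
  (S : FibreScheme p K)

/-- The piece of `V` in the ball of generation `k` about `j`. -/
def cell (k : ℕ) (V : Set Z) (j : Z) : Set Z := V ∩ Metric.ball j (S.δ k)

/-- The total weight of the pieces of `V` of generation `k`. -/
def total (k : ℕ) (V : Set Z) (x : X) : ℝ := ∑ j ∈ S.centres k, S.mass (S.cell k V j) x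

/-- The sum of `f` over sample points of the `n`-fold refinement of `V` that begins with
generation `k`. Every step distributes the weight of a set over its pieces `W` in proportion to
the numbers `mass W x`. -/
noncomputable def average : ℕ → ℕ → Set Z → (Z → ℝ) → X → ℝ
  | 0, _, V, f, x => S.mass V x * f (S.point V)
  | n + 1, k, V, f, x =>
    S.mass V x / S.total k V x * ∑ j ∈ S.centres k, average n (k + 1) (S.cell k V j) f x

theorem isOpen_cell {V : Set Z} (hV : IsOpen V) (k : ℕ) (j : Z) : IsOpen (S.cell k V j) :=
  hV.inter Metric.isOpen_ball

theorem cell_subset {V : Set Z} (hVK : V ⊆ K) (k : ℕ) (j : Z) : S.cell k V j ⊆ K :=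
  Set.inter_subset_left.trans hVK

theorem total_pos {V : Set Z} (hV : IsOpen V) (hVK : V ⊆ K) (k : ℕ) {x : X}
    (hx : 0 < S.mass V x) : 0 < S.total k V x := by
  obtain ⟨y, hyV, hy⟩ := (S.mass_pos V x hV).1 hx
  obtain ⟨j, hj, hyj⟩ := S.cover k y (hVK hyV)
  exact Finset.sum_pos' (fun i _ => S.mass_nonneg _ x)
    ⟨j, hj, (S.mass_pos _ x (S.isOpen_cell hV k j)).2 ⟨y, ⟨hyV, hyj⟩, hy⟩⟩

/-- A bound on all pieces passes to the set itself. Where `mass V` vanishes both sides are zero,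
whether or not the quotient is `0 / 0`. -/
theorem distribute_le {V : Set Z} (hV : IsOpen V) (hVK : V ⊆ K) (k : ℕ) {x : X} {a : Z → ℝ}
    {c : ℝ} (ha : ∀ j ∈ S.centres k, a j ≤ c * S.mass (S.cell k V j) x) :
    S.mass V x / S.total k V x * ∑ j ∈ S.centres k, a j ≤ c * S.mass V x := by
  rcases (S.mass_nonneg V x).eq_or_lt with h | h
  · simp [← h]
  · have ht := S.total_pos hV hVK k h
    calc S.mass V x / S.total k V x * ∑ j ∈ S.centres k, a j
        ≤ S.mass V x / S.total k V x * (c * S.total k V x) := by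
          refine mul_le_mul_of_nonneg_left ?_ (div_nonneg h.le ht.le)
          rw [total, Finset.mul_sum]
          exact Finset.sum_le_sum ha
      _ = c * S.mass V x := by field_simp

theorem average_add (n k : ℕ) (V : Set Z) (f g : Z → ℝ) (x : X) :
    S.average n k V (f + g) x = S.average n k V f x + S.average n k V g x := by
  induction n generalizing k V with
  | zero => simp [average, mul_add]
  | succ n ih => simp [average, ih, Finset.sum_add_distrib, mul_add]

theorem average_smul (n k : ℕ) (V : Set Z) (c : ℝ) (f : Z → ℝ) (x : X) :
    S.average n k V (c • f) x = c * S.average n k V f x := by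
  induction n generalizing k V with
  | zero => simp [average]; ring
  | succ n ih => simp only [average, ih, ← Finset.mul_sum]; ring

theorem average_neg (n k : ℕ) (V : Set Z) (f : Z → ℝ) (x : X) :
    S.average n k V (-f) x = -S.average n k V f x := by
  have := S.average_smul n k V (-1) f x
  simpa using this

theorem average_le {V : Set Z} (hV : IsOpen V) (hVK : V ⊆ K) (n k : ℕ) {f : Z → ℝ} {c : ℝ}
    (hf : ∀ y ∈ V, f y ≤ c) (x : X) : S.average n k V f x ≤ c * S.mass V x := by
  induction n generalizing k V with
  | zero =>
    rcases (S.mass_nonneg V x).eq_or_lt with h | h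
    · simp [average, ← h]
    · obtain ⟨y, hy, -⟩ := (S.mass_pos V x hV).1 h
      rw [average, mul_comm]
      exact mul_le_mul_of_nonneg_right (hf _ (S.point_mem V ⟨y, hy⟩)) h.le
  | succ n ih =>
    exact S.distribute_le hV hVK k fun j _ =>
      ih (S.isOpen_cell hV k j) (S.cell_subset hVK k j) (k + 1) fun y hy => hf y hy.1

theorem le_average {V : Set Z} (hV : IsOpen V) (hVK : V ⊆ K) (n k : ℕ) {f : Z → ℝ} {c : ℝ}
    (hf : ∀ y ∈ V, c ≤ f y) (x : X) : c * S.mass V x ≤ S.average n k V f x := by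
  have := S.average_le hV hVK n k (f := -f) (c := -c) (fun y hy => neg_le_neg (hf y hy)) x
  rw [average_neg] at this
  linarith

/-- The averages are nearly bounded by the values of `f` on the fibre alone, since every sample
point that contributes over `x` is close to the fibre of `x`. -/
theorem average_le_of_fibre {V : Set Z} (hV : IsOpen V) (hVK : V ⊆ K) (n k : ℕ) {f : Z → ℝ}
    {c ε : ℝ} {x : X} (hf : ∀ y ∈ V, p y = x → f y ≤ c)
    (hosc : ∀ j, ∀ y ∈ Metric.ball j (S.δ (k + n)), ∀ y' ∈ Metric.ball j (S.δ (k + n)),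
      f y ≤ f y' + ε) : S.average (n + 1) k V f x ≤ (c + ε) * S.mass V x := by
  induction n generalizing k V with
  | zero =>
    refine S.distribute_le hV hVK k fun j _ => ?_
    rcases (S.mass_nonneg (S.cell k V j) x).eq_or_lt with h | h
    · simp [average, ← h]
    · obtain ⟨y, hy, hyx⟩ := (S.mass_pos _ x (S.isOpen_cell hV k j)).1 h
      rw [average, mul_comm]
      refine mul_le_mul_of_nonneg_right ?_ h.le
      have h1 := hosc j _ (S.point_mem _ ⟨y, hy⟩).2 y hy.2
      have h2 := hf y hy.1 hyx
      linarith
  | succ n ih =>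
    refine S.distribute_le hV hVK k fun j _ =>
      ih (S.isOpen_cell hV k j) (S.cell_subset hVK k j) (k + 1) (fun y hy => hf y hy.1) ?_
    rwa [show k + 1 + n = k + (n + 1) by ring]

/-- Refining the sample points beyond a generation where `f` varies by at most `ε` on each ball
changes the average by at most `ε` times the mass. -/
theorem average_sub_average_le {V : Set Z} (hV : IsOpen V) (hVK : V ⊆ K) (n k a : ℕ) {f : Z → ℝ}
    {ε : ℝ} (x : X)
    (hosc : ∀ j, ∀ y ∈ Metric.ball j (S.δ (k + n)), ∀ y' ∈ Metric.ball j (S.δ (k + n)),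
      f y ≤ f y' + ε) :
    S.average (n + a + 1) k V f x - S.average (n + 1) k V f x ≤ ε * S.mass V x := by
  induction n generalizing k V with
  | zero =>
    rw [average, average, ← mul_sub, ← Finset.sum_sub_distrib]
    refine S.distribute_le hV hVK k fun j _ => ?_
    rcases (S.cell k V j).eq_empty_or_nonempty with h | h
    · have h0 := S.average_le (S.isOpen_cell hV k j) (S.cell_subset hVK k j) (0 + a) (k + 1)
        (f := f) (c := 0) (by simp [h]) x
      have h1 : S.mass (S.cell k V j) x = 0 := by
        refine le_antisymm (not_lt.1 fun hp => ?_) (S.mass_nonneg _ x)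
        obtain ⟨y, hy, -⟩ := (S.mass_pos _ x (S.isOpen_cell hV k j)).1 hp
        simp [h] at hy
      simp only [average, h1] at h0 ⊢
      linarith
    · have h0 := S.average_le (S.isOpen_cell hV k j) (S.cell_subset hVK k j) (0 + a) (k + 1)
        (f := f) (c := f (S.point (S.cell k V j)) + ε)
        (fun y hy => hosc j y hy.2 _ (S.point_mem _ h).2) x
      simp only [average]
      linarith
  | succ n ih =>
    rw [show n + 1 + a + 1 = n + a + 1 + 1 by ring, average, average, ← mul_sub,
      ← Finset.sum_sub_distrib]
    refine S.distribute_le hV hVK k fun j _ =>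
      ih (S.isOpen_cell hV k j) (S.cell_subset hVK k j) (k + 1) ?_
    rwa [show k + 1 + n = k + (n + 1) by ring]

theorem abs_average_sub_average_le {V : Set Z} (hV : IsOpen V) (hVK : V ⊆ K) (n k a : ℕ)
    {f : Z → ℝ} {ε : ℝ} (x : X)
    (hosc : ∀ j, ∀ y ∈ Metric.ball j (S.δ (k + n)), ∀ y' ∈ Metric.ball j (S.δ (k + n)),
      f y ≤ f y' + ε) :
    |S.average (n + a + 1) k V f x - S.average (n + 1) k V f x| ≤ ε * S.mass V x := by
  have h1 := S.average_sub_average_le hV hVK n k a x hosc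
  have h2 := S.average_sub_average_le hV hVK n k a (f := -f) (ε := ε) x
    (fun j y hy y' hy' => by have := hosc j y' hy' y hy; simp only [Pi.neg_apply]; linarith)
  rw [average_neg, average_neg] at h2
  exact abs_le.2 ⟨by linarith, h1⟩

theorem continuous_average {V : Set Z} (hV : IsOpen V) (hVK : V ⊆ K) (n k : ℕ) {f : Z → ℝ}
    {c : ℝ} (hf : ∀ y, |f y| ≤ c) : Continuous (S.average n k V f) := by
  induction n generalizing k V with
  | zero => exact (S.continuous_mass V hV).mul continuous_const
  | succ n ih =>
    rw [continuous_iff_continuousAt]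
    intro x₀
    rcases (S.mass_nonneg V x₀).eq_or_lt with h | h
    · -- where the mass vanishes, the quotient of masses is controlled by the bound on `f`
      have hb : ∀ x, |S.average (n + 1) k V f x| ≤ c * S.mass V x := fun x => abs_le.2
        ⟨by linarith [S.le_average hV hVK (n + 1) k (f := f) (c := -c)
              (fun y _ => (abs_le.1 (hf y)).1) x],
          S.average_le hV hVK (n + 1) k (fun y _ => (abs_le.1 (hf y)).2) x⟩
      have h0 : S.average (n + 1) k V f x₀ = 0 := by simp [average, ← h]
      rw [ContinuousAt, h0]
      refine squeeze_zero_norm hb ?_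
      have hc : Continuous fun x => c * S.mass V x := continuous_const.mul (S.continuous_mass V hV)
      have := hc.tendsto x₀
      rwa [← h, mul_zero] at this
    · have ht : Continuous (S.total k V) :=
        continuous_finsetSum _ fun j _ => S.continuous_mass _ (S.isOpen_cell hV k j)
      have hs : Continuous fun x =>
          ∑ j ∈ S.centres k, S.average n (k + 1) (S.cell k V j) f x :=
        continuous_finsetSum _ fun j _ => ih (S.isOpen_cell hV k j) (S.cell_subset hVK k j) (k + 1)
      exact (((S.continuous_mass V hV).continuousAt).div ht.continuousAt
        (S.total_pos hV hVK k h).ne').mul hs.continuousAt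

theorem exists_forall_osc_le (hδ : Filter.Tendsto S.δ Filter.atTop (𝓝 0)) {f : Z → ℝ}
    (hf : UniformContinuous f) {ε : ℝ} (hε : 0 < ε) :
    ∃ l, ∀ j, ∀ y ∈ Metric.ball j (S.δ l), ∀ y' ∈ Metric.ball j (S.δ l), f y ≤ f y' + ε := by
  obtain ⟨η, hη, h⟩ := Metric.uniformContinuous_iff.1 hf ε hε
  obtain ⟨l, hl⟩ := (hδ.eventually_lt_const (half_pos hη)).exists
  refine ⟨l, fun j y hy y' hy' => ?_⟩
  have h1 : dist y y' < η := by
    have := dist_triangle_right y y' j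
    rw [Metric.mem_ball] at hy hy'
    linarith
  have := (abs_lt.1 (h h1)).2
  linarith

/-- The limit of the averages of `f` over finer and finer sets of sample points. -/
noncomputable def limit (V : Set Z) (f : Z → ℝ) (x : X) : ℝ :=
  Filter.limUnder Filter.atTop fun n => S.average n 0 V f x

theorem tendstoUniformly_average (hδ : Filter.Tendsto S.δ Filter.atTop (𝓝 0)) {V : Set Z}
    (hV : IsOpen V) (hVK : V ⊆ K) {f : Z → ℝ} (hf : UniformContinuous f) :
    TendstoUniformly (fun n => S.average n 0 V f) (S.limit V f) Filter.atTop := by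
  have key : ∀ ε > 0, ∃ N, ∀ n ≥ N, ∀ x, |S.average n 0 V f x - S.average N 0 V f x| ≤ ε := by
    intro ε hε
    obtain ⟨l, hl⟩ := S.exists_forall_osc_le hδ hf hε
    refine ⟨l + 1, fun n hn x => ?_⟩
    obtain ⟨a, rfl⟩ := Nat.exists_eq_add_of_le hn
    have := S.abs_average_sub_average_le hV hVK l 0 a x (by simpa using hl)
    rw [show l + a + 1 = l + 1 + a by ring] at this
    exact this.trans (mul_le_of_le_one_right hε.le (S.mass_le_one V x))
  have hlim : ∀ x, Filter.Tendsto (fun n => S.average n 0 V f x) Filter.atTop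
      (𝓝 (S.limit V f x)) := by
    intro x
    refine CauchySeq.tendsto_limUnder (Metric.cauchySeq_iff'.2 fun ε hε => ?_)
    obtain ⟨N, hN⟩ := key (ε / 2) (half_pos hε)
    exact ⟨N, fun n hn => lt_of_le_of_lt (hN n hn x) (half_lt_self hε)⟩
  rw [Metric.tendstoUniformly_iff]
  intro ε hε
  obtain ⟨N, hN⟩ := key (ε / 3) (by positivity)
  filter_upwards [Filter.eventually_ge_atTop N] with n hn x
  have h1 : |S.limit V f x - S.average N 0 V f x| ≤ ε / 3 :=
    le_of_tendsto ((hlim x).sub_const _).abs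
      (Filter.eventually_atTop.2 ⟨N, fun n hn => hN n hn x⟩)
  have h2 := hN n hn x
  rw [Real.dist_eq]
  have := abs_sub_le (S.limit V f x) (S.average N 0 V f x) (S.average n 0 V f x)
  rw [abs_sub_comm (S.average N 0 V f x)] at this
  linarith

theorem tendsto_average (hδ : Filter.Tendsto S.δ Filter.atTop (𝓝 0)) {V : Set Z}
    (hV : IsOpen V) (hVK : V ⊆ K) {f : Z → ℝ} (hf : UniformContinuous f) (x : X) :
    Filter.Tendsto (fun n => S.average n 0 V f x) Filter.atTop (𝓝 (S.limit V f x)) :=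
  (S.tendstoUniformly_average hδ hV hVK hf).tendsto_at x

theorem limit_le_of_fibre (hδ : Filter.Tendsto S.δ Filter.atTop (𝓝 0)) {V : Set Z}
    (hV : IsOpen V) (hVK : V ⊆ K) {f : Z → ℝ} (hf : UniformContinuous f) {c : ℝ} {x : X}
    (hfc : ∀ y ∈ V, p y = x → f y ≤ c) : S.limit V f x ≤ c * S.mass V x := by
  refine le_of_forall_pos_le_add fun ε hε => ?_
  obtain ⟨l, hl⟩ := S.exists_forall_osc_le hδ hf (half_pos hε)
  have h1 := S.average_le_of_fibre hV hVK l 0 hfc (by simpa using hl)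
  have h2 : S.limit V f x - S.average (l + 1) 0 V f x ≤ ε / 2 := by
    refine le_of_tendsto ((S.tendsto_average hδ hV hVK hf x).sub_const _)
      (Filter.eventually_atTop.2 ⟨l + 1, fun n hn => ?_⟩)
    obtain ⟨a, rfl⟩ := Nat.exists_eq_add_of_le hn
    have := S.average_sub_average_le hV hVK l 0 a x (by simpa using hl)
    rw [show l + a + 1 = l + 1 + a by ring] at this
    exact this.trans (mul_le_of_le_one_right (half_pos hε).le (S.mass_le_one V x))
  have h3 : ε / 2 * S.mass V x ≤ ε / 2 :=
    mul_le_of_le_one_right (half_pos hε).le (S.mass_le_one V x)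
  linarith

theorem mass_le_limit (hδ : Filter.Tendsto S.δ Filter.atTop (𝓝 0)) {V : Set Z}
    (hV : IsOpen V) (hVK : V ⊆ K) {f : Z → ℝ} (hf : UniformContinuous f) {c : ℝ} {x : X}
    (hfc : ∀ y ∈ V, c ≤ f y) : c * S.mass V x ≤ S.limit V f x :=
  ge_of_tendsto' (S.tendsto_average hδ hV hVK hf x) fun n => S.le_average hV hVK n 0 hfc x

end FibreScheme

theorem exists_fibreScheme {Z X : Type*} [PseudoMetricSpace Z] [Nonempty Z] [TopologicalSpace X]
    [PerfectlyNormalSpace X] {p : Z → X} (hp : IsOpenMap p) {K : Set Z} (hK : IsCompact K) :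
    ∃ S : FibreScheme p K, Filter.Tendsto S.δ Filter.atTop (𝓝 0) := by
  have hm : ∀ V : Set Z, ∃ m : X → ℝ, (∀ x, 0 ≤ m x) ∧ (∀ x, m x ≤ 1) ∧
      (IsOpen V → Continuous m ∧ ∀ x, 0 < m x ↔ ∃ y ∈ V, p y = x) := by
    intro V
    by_cases hV : IsOpen V
    · obtain ⟨f, hf, hf'⟩ := perfectlyNormalSpace_iff_forall_isClosed_preimage_zero.1
        ‹PerfectlyNormalSpace X› _ (hp V hV).isClosed_compl
      refine ⟨f, fun x => (hf' x).1, fun x => (hf' x).2, fun _ => ⟨f.continuous, fun x => ?_⟩⟩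
      have h1 : x ∈ (p '' V)ᶜ ↔ f x = 0 := by rw [hf]; rfl
      rw [(hf' x).1.lt_iff_ne', ne_eq, ← h1, Set.notMem_compl_iff]
      rfl
    · exact ⟨0, by simp, by simp, fun h => absurd h hV⟩
  choose m hm0 hm1 hm using hm
  have hc : ∀ k : ℕ, ∃ t : Finset Z, ∀ z ∈ K, ∃ j ∈ t, z ∈ Metric.ball j (1 / ((k : ℝ) + 1)) := by
    intro k
    obtain ⟨t, -, ht, hcov⟩ := hK.finite_cover_balls (e := 1 / ((k : ℝ) + 1)) (by positivity)
    refine ⟨ht.toFinset, fun z hz => ?_⟩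
    simpa using hcov hz
  choose t ht using hc
  let S : FibreScheme p K :=
    { mass := m
      point := fun V => Classical.epsilon (· ∈ V)
      centres := t
      δ := fun k => 1 / ((k : ℝ) + 1)
      continuous_mass := fun V hV => (hm V hV).1
      mass_nonneg := hm0
      mass_le_one := hm1
      mass_pos := fun V x hV => (hm V hV).2 x
      point_mem := fun V hV => Classical.epsilon_spec hV
      cover := ht }
  exact ⟨S, tendsto_one_div_add_atTop_nhds_zero_nat⟩

/-- Every relatively compact open set `V` carries a continuous system of measures for an open map
that does not vanish over the image of `V`. -/
theorem exists_isContinuousSystem {Z X : Type*} [TopologicalSpace Z] [T2Space Z]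
    [LocallyCompactSpace Z] [SecondCountableTopology Z] [MeasurableSpace Z] [BorelSpace Z]
    [Nonempty Z] [TopologicalSpace X] [PerfectlyNormalSpace X] [T1Space X] {p : Z → X}
    (hpc : Continuous p) (hp : IsOpenMap p) {V : Set Z} (hV : IsOpen V) (hVc : IsCompact (closure V)) :
    ∃ β : X → Measure Z, IsContinuousSystem p β ∧ (∀ x, β x (closure V)ᶜ = 0) ∧
      ∀ y ∈ V, β (p y) ≠ 0 := by
  let := TopologicalSpace.metrizableSpaceMetric Z
  obtain ⟨S, hδ⟩ := exists_fibreScheme hp hVc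
  have hVK : V ⊆ closure V := subset_closure
  have huc : ∀ {f : Z → ℝ}, Continuous f → HasCompactSupport f → UniformContinuous f :=
    fun hf hf' => hf'.uniformContinuous_of_continuous hf
  have hriesz : ∀ x, ∃ μ : Measure Z, μ.Regular ∧ ∀ f : Z → ℝ, Continuous f →
      HasCompactSupport f → ∫ z, f z ∂μ = S.limit V f x := by
    intro x
    refine exists_regular_measure_of_functional (fun f => S.limit V f x)
      (fun f g hf hf' hg hg' => ?_) (fun c f hf hf' => ?_) (fun f hf hf' h0 => ?_)
    · refine tendsto_nhds_unique
        (S.tendsto_average hδ hV hVK ((huc hf hf').add (huc hg hg')) x) ?_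
      refine ((S.tendsto_average hδ hV hVK (huc hf hf') x).add
        (S.tendsto_average hδ hV hVK (huc hg hg') x)).congr fun n => ?_
      exact (S.average_add n 0 V f g x).symm
    · refine tendsto_nhds_unique
        (S.tendsto_average hδ hV hVK ((huc hf hf').const_smul c) x) ?_
      refine ((S.tendsto_average hδ hV hVK (huc hf hf') x).const_mul c).congr fun n => ?_
      exact (S.average_smul n 0 V c f x).symm
    · simpa using S.mass_le_limit hδ hV hVK (huc hf hf') (c := 0) (x := x) fun y _ => h0 y
  choose β hreg hβ using hriesz
  have hnull : ∀ x (O : Set Z), IsOpen O → (∀ y ∈ V, p y = x → y ∉ O) → β x O = 0 := by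
    intro x O hO hVO
    have := hreg x
    refine measure_eq_zero_of_integral_eq_zero hO fun f hf hf' h0 hfO => ?_
    rw [hβ x f hf hf']
    refine le_antisymm ?_ ?_
    · simpa using S.limit_le_of_fibre hδ hV hVK (huc hf hf') (c := 0) (x := x)
        fun y hy hyx => (hfO y (hVO y hy hyx)).le
    · simpa using S.mass_le_limit hδ hV hVK (huc hf hf') (c := 0) (x := x) fun y _ => h0 y
  refine ⟨β, ⟨hreg, fun x => hnull x _ ?_ ?_, fun f hf hf' => ?_⟩, fun x => hnull x _ ?_ ?_,
    fun y hy h0 => ?_⟩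
  · exact (isClosed_singleton.preimage hpc).isOpen_compl
  · exact fun y _ hyx h => h hyx
  · simp only [hβ _ f hf hf']
    obtain ⟨c, hc⟩ := hf'.exists_bound_of_continuous hf
    exact (S.tendstoUniformly_average hδ hV hVK (huc hf hf')).continuous
      (Filter.Frequently.of_forall fun n => S.continuous_average hV hVK n 0 hc)
  · exact isClosed_closure.isOpen_compl
  · exact fun y hy _ h => h (hVK hy)
  · obtain ⟨f, hf1, -, hfc, hf⟩ := exists_continuous_one_zero_of_isCompact hVc isClosed_empty
      (Set.disjoint_empty _)
    have h1 := S.mass_le_limit hδ hV hVK (huc f.continuous hfc) (c := 1) (x := p y)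
      fun z hz => (hf1 (hVK hz)).ge
    have h2 := (S.mass_pos V (p y) hV).2 ⟨y, hy, rfl⟩
    rw [← hβ _ f f.continuous hfc, h0] at h1
    simp at h1
    linarith

end FibreScheme

/-! ### Translations, groupoid actions and the space of an equivalence -/

section Groupoid

variable {G X : Type*} [TopologicalSpace G] [TopologicalSpace X] (𝒢 : TopGroupoid G X)

theorem TopGroupoid.mul_congr {x x' y y' : G} (h : 𝒢.s x = 𝒢.r y) (h' : 𝒢.s x' = 𝒢.r y')
    (hx : x = x') (hy : y = y') : 𝒢.mul x y h = 𝒢.mul x' y' h' := by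
  subst hx hy; rfl

open Classical in
/-- Left translation by `k`, extended by a constant outside the fibre where the product is
defined; the constant is `k` so that the values always have the same range as `k`. -/
noncomputable def TopGroupoid.leftMul (k y : G) : G :=
  if h : 𝒢.s k = 𝒢.r y then 𝒢.mul k y h else k

theorem TopGroupoid.leftMul_of_eq {k y : G} (h : 𝒢.s k = 𝒢.r y) :
    𝒢.leftMul k y = 𝒢.mul k y h := dif_pos h

theorem TopGroupoid.r_leftMul (k y : G) : 𝒢.r (𝒢.leftMul k y) = 𝒢.r k := by
  unfold TopGroupoid.leftMul
  split_ifs with h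
  · exact 𝒢.r_mul k y h
  · rfl

theorem TopGroupoid.leftMul_inv_leftMul {k y : G} (h : 𝒢.s k = 𝒢.r y) :
    𝒢.leftMul (𝒢.inv k) (𝒢.leftMul k y) = y := by
  have h1 : 𝒢.s (𝒢.inv k) = 𝒢.r k := 𝒢.s_inv k
  rw [𝒢.leftMul_of_eq h, 𝒢.leftMul_of_eq (h1.trans (𝒢.r_mul k y h).symm),
    ← 𝒢.mul_assoc (𝒢.inv k) k y h1 h, 𝒢.mul_congr _ (𝒢.s_unit _) ((𝒢.inv_mul k).trans
      (by rw [h])) rfl, 𝒢.unit_mul]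

theorem TopGroupoid.continuousOn_leftMul (k : G) :
    ContinuousOn (𝒢.leftMul k) {y | 𝒢.r y = 𝒢.s k} := by
  rw [continuousOn_iff_continuous_domRestrict]
  have : Continuous fun y : {y | 𝒢.r y = 𝒢.s k} =>
      (⟨(k, y.1), y.2.symm⟩ : {p : G × G // 𝒢.s p.1 = 𝒢.r p.2}) := by fun_prop
  refine (𝒢.continuous_mul.comp this).congr fun y => ?_
  exact (𝒢.leftMul_of_eq y.2.symm).symm

theorem TopGroupoid.isCompact_leftMul_preimage [T2Space X] (k : G) {C : Set G}
    (hC : IsCompact C) :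
    ∃ S : Set G, IsCompact S ∧ ∀ y, 𝒢.s k = 𝒢.r y → 𝒢.leftMul k y ∈ C → y ∈ S := by
  refine ⟨𝒢.leftMul (𝒢.inv k) '' (C ∩ {y | 𝒢.r y = 𝒢.s (𝒢.inv k)}), ?_, fun y hy hyC => ?_⟩
  · refine (hC.inter_right ?_).image_of_continuousOn
      ((𝒢.continuousOn_leftMul _).mono Set.inter_subset_right)
    exact isClosed_eq 𝒢.continuous_r continuous_const
  · exact ⟨_, ⟨hyC, by simp [𝒢.r_leftMul, 𝒢.s_inv]⟩, 𝒢.leftMul_inv_leftMul hy⟩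

end Groupoid

section FibreMeasure

variable {G X : Type*} [TopologicalSpace G] [T2Space G] [LocallyCompactSpace G]
  [SecondCountableTopology G] [MeasurableSpace G] [BorelSpace G]
  [TopologicalSpace X] [T2Space X]

theorem TopGroupoid.aemeasurable_leftMul (𝒢 : TopGroupoid G X) (k : G) {μ : Measure G}
    (hμ : μ {y | 𝒢.r y = 𝒢.s k}ᶜ = 0) : AEMeasurable (𝒢.leftMul k) μ := by
  have hD : MeasurableSet {y | 𝒢.r y = 𝒢.s k} :=
    (isClosed_eq 𝒢.continuous_r continuous_const).measurableSet
  rw [← Measure.restrict_eq_self_of_ae_mem (μ := μ) (s := {y | 𝒢.r y = 𝒢.s k}) hμ]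
  exact (𝒢.continuousOn_leftMul k).aemeasurable hD

theorem TopGroupoid.map_leftMul_apply (𝒢 : TopGroupoid G X) (k : G) {μ : Measure G}
    (hμ : μ {y | 𝒢.r y = 𝒢.s k}ᶜ = 0) {A : Set G} (hA : MeasurableSet A) :
    μ.map (𝒢.leftMul k) A = μ {y | ∃ h : 𝒢.s k = 𝒢.r y, 𝒢.mul k y h ∈ A} := by
  rw [Measure.map_apply_of_aemeasurable (𝒢.aemeasurable_leftMul k hμ) hA]
  have hae : ∀ᵐ y ∂μ, 𝒢.r y = 𝒢.s k := ae_iff.2 hμ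
  refine measure_congr ?_
  filter_upwards [hae] with y hy
  apply propext
  change 𝒢.leftMul k y ∈ A ↔ ∃ h : 𝒢.s k = 𝒢.r y, 𝒢.mul k y h ∈ A
  rw [𝒢.leftMul_of_eq hy.symm]
  exact ⟨fun h => ⟨hy.symm, h⟩, fun h => h.2⟩

namespace HaarSystem

variable {𝒢 : TopGroupoid G X} (lam : HaarSystem 𝒢)

theorem isContinuousSystem : IsContinuousSystem 𝒢.r lam.measure where
  regular := lam.regular
  fibre x := by
    rw [← lam.support_eq x]
    exact Measure.measure_compl_support
  continuous_integral f hf hf' := by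
    have h := lam.continuous_integral (fun x => (f x : ℂ)) (by fun_prop)
      (hf'.comp_left (g := ((↑) : ℝ → ℂ)) Complex.ofReal_zero)
    refine (Complex.continuous_re.comp h).congr fun x => ?_
    simp only [Function.comp_apply]
    rw [integral_complex_ofReal, Complex.ofReal_re]

/-- Left invariance as an equality of measures. -/
theorem map_leftMul (k : G) :
    (lam.measure (𝒢.s k)).map (𝒢.leftMul k) = lam.measure (𝒢.r k) := by
  ext A hA
  rw [𝒢.map_leftMul_apply k (lam.isContinuousSystem.fibre _) hA, lam.left_invariant k A hA]

theorem integral_leftMul (k : G) {F : G → ℝ} (hF : ContinuousOn F {g | 𝒢.r g = 𝒢.r k}) :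
    ∫ y, F (𝒢.leftMul k y) ∂(lam.measure (𝒢.s k)) = ∫ g, F g ∂(lam.measure (𝒢.r k)) := by
  have hae := lam.isContinuousSystem.fibre (𝒢.s k)
  have hae' := lam.isContinuousSystem.fibre (𝒢.r k)
  rw [← lam.map_leftMul k] at hae' ⊢
  refine (integral_map (𝒢.aemeasurable_leftMul k hae) ?_).symm
  rw [← Measure.restrict_eq_self_of_ae_mem (s := {g | 𝒢.r g = 𝒢.r k}) hae']
  exact hF.aestronglyMeasurable (isClosed_eq 𝒢.continuous_r continuous_const).measurableSet

end HaarSystem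

end FibreMeasure

section Actions

variable {G X H Y Z : Type*} [TopologicalSpace G] [TopologicalSpace X]
  [TopologicalSpace H] [TopologicalSpace Y] [TopologicalSpace Z]
  {𝒢 : TopGroupoid G X} {ℋ : TopGroupoid H Y}

theorem LeftAction.act_congr (A : LeftAction 𝒢 Z) {g g' : G} {z z' : Z}
    (h : 𝒢.s g = A.moment z) (h' : 𝒢.s g' = A.moment z') (hg : g = g') (hz : z = z') :
    A.act g z h = A.act g' z' h' := by
  subst hg hz; rfl

theorem RightAction.act_congr (B : RightAction ℋ Z) {h h' : H} {z z' : Z}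
    (e : B.moment z = ℋ.r h) (e' : B.moment z' = ℋ.r h') (hz : z = z') (hh : h = h') :
    B.act z h e = B.act z' h' e' := by
  subst hh hz; rfl

theorem RightAction.act_inv (B : RightAction ℋ Z) {y z : Z} {h : H} (e : B.moment y = ℋ.r h)
    (hz : B.act y h e = z) (e' : B.moment z = ℋ.r (ℋ.inv h)) : B.act z (ℋ.inv h) e' = y := by
  subst hz
  rw [← B.act_mul y h (ℋ.inv h) e (ℋ.r_inv h).symm,
    B.act_congr _ (ℋ.r_unit (B.moment y)).symm rfl ((ℋ.mul_inv h).trans (by rw [e])), B.act_unit]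

theorem RightAction.isCompact_act [T2Space Y] (B : RightAction ℋ Z) {K : Set Z}
    {C : Set H} (hK : IsCompact K) (hC : IsCompact C) :
    IsCompact {w | ∃ z ∈ K, ∃ h ∈ C, ∃ e : B.moment z = ℋ.r h, B.act z h e = w} := by
  have hcl : IsClosed {p : Z × H | B.moment p.1 = ℋ.r p.2} :=
    isClosed_eq (B.continuous_moment.comp continuous_fst) (ℋ.continuous_r.comp continuous_snd)
  have h1 : IsCompact ((↑) ⁻¹' (K ×ˢ C) : Set {p : Z × H // B.moment p.1 = ℋ.r p.2}) :=
    hcl.isClosedEmbedding_subtypeVal.isCompact_preimage (hK.prod hC)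
  convert h1.image B.continuous_act using 1
  ext w
  constructor
  · rintro ⟨z, hz, h, hh, e, rfl⟩
    exact ⟨⟨(z, h), e⟩, ⟨hz, hh⟩, rfl⟩
  · rintro ⟨⟨⟨z, h⟩, e⟩, ⟨hz, hh⟩, rfl⟩
    exact ⟨z, hz, h, hh, e, rfl⟩

open Classical in
/-- The map `(g, z) ↦ g⁻¹ • z`, extended by `z` where it is not defined. -/
noncomputable def LeftAction.invAct (A : LeftAction 𝒢 Z) (g : G) (z : Z) : Z :=
  if h : 𝒢.r g = A.moment z then A.act (𝒢.inv g) z ((𝒢.s_inv g).trans h) else z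

theorem LeftAction.invAct_of_eq (A : LeftAction 𝒢 Z) {g : G} {z : Z} (h : 𝒢.r g = A.moment z) :
    A.invAct g z = A.act (𝒢.inv g) z ((𝒢.s_inv g).trans h) := dif_pos h

theorem LeftAction.moment_invAct (A : LeftAction 𝒢 Z) {g : G} {z : Z}
    (h : 𝒢.r g = A.moment z) : A.moment (A.invAct g z) = 𝒢.s g := by
  rw [A.invAct_of_eq h, A.moment_act, 𝒢.r_inv]

theorem LeftAction.act_invAct (A : LeftAction 𝒢 Z) {g : G} {z : Z} (h : 𝒢.r g = A.moment z) :
    A.act g (A.invAct g z) (A.moment_invAct h).symm = z := by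
  rw [A.act_congr _ ((𝒢.r_inv g).symm.trans (A.moment_act _ _ ((𝒢.s_inv g).trans h)).symm) rfl
    (A.invAct_of_eq h), ← A.mul_act g (𝒢.inv g) z (𝒢.r_inv g).symm ((𝒢.s_inv g).trans h),
    A.act_congr _ (𝒢.s_unit (A.moment z)) ((𝒢.mul_inv g).trans (by rw [h])) rfl, A.unit_act]

theorem LeftAction.invAct_act (A : LeftAction 𝒢 Z) {g : G} {w : Z} (h : 𝒢.s g = A.moment w) :
    A.invAct g (A.act g w h) = w := by
  rw [A.invAct_of_eq (A.moment_act g w h).symm, ← A.mul_act (𝒢.inv g) g w (𝒢.s_inv g) h,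
    A.act_congr _ (𝒢.s_unit (A.moment w)) ((𝒢.inv_mul g).trans (by rw [h])) rfl, A.unit_act]

theorem LeftAction.invAct_unit (A : LeftAction 𝒢 Z) (z : Z) :
    A.invAct (𝒢.unit (A.moment z)) z = z := by
  have h := A.invAct_act (𝒢.s_unit (A.moment z))
  rwa [A.unit_act] at h

/-- `(k y)⁻¹ • (k • z) = y⁻¹ • z` -/
theorem LeftAction.invAct_leftMul (A : LeftAction 𝒢 Z) {k y : G} {z : Z}
    (hk : 𝒢.s k = A.moment z) (hy : 𝒢.s k = 𝒢.r y) :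
    A.invAct (𝒢.leftMul k y) (A.act k z hk) = A.invAct y z := by
  have hyz : 𝒢.r y = A.moment z := hy.symm.trans hk
  have h1 : 𝒢.s (𝒢.mul k y hy) = A.moment (A.invAct y z) := by
    rw [𝒢.s_mul, A.moment_invAct hyz]
  have h2 : A.act (𝒢.mul k y hy) (A.invAct y z) h1 = A.act k z hk := by
    rw [A.mul_act k y _ hy (A.moment_invAct hyz).symm]
    exact A.act_congr _ _ rfl (A.act_invAct hyz)
  rw [𝒢.leftMul_of_eq hy, ← h2, A.invAct_act]

theorem LeftAction.continuousOn_invAct (A : LeftAction 𝒢 Z) :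
    ContinuousOn (fun a : Z × G => A.invAct a.2 a.1) {a | A.moment a.1 = 𝒢.r a.2} := by
  rw [continuousOn_iff_continuous_domRestrict]
  have hc : Continuous 𝒢.inv := 𝒢.continuous_inv
  have : Continuous fun a : {a : Z × G | A.moment a.1 = 𝒢.r a.2} =>
      (⟨(𝒢.inv a.1.2, a.1.1), (𝒢.s_inv _).trans a.2.symm⟩ :
        {p : G × Z // 𝒢.s p.1 = A.moment p.2}) := by fun_prop
  refine (A.continuous_act.comp this).congr fun a => ?_
  exact (A.invAct_of_eq a.2.symm).symm

/-- For a proper action, the arrows `g` for which `g⁻¹` moves a point of `C` into `K` form a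
relatively compact set. -/
theorem LeftAction.IsProper.exists_isCompact {A : LeftAction 𝒢 Z} (hA : A.IsProper)
    {C K : Set Z} (hC : IsCompact C) (hK : IsCompact K) :
    ∃ S : Set G, IsCompact S ∧
      ∀ g, ∀ z ∈ C, 𝒢.r g = A.moment z → A.invAct g z ∈ K → g ∈ S := by
  refine ⟨_, (hA.isCompact_preimage (hC.prod hK)).image
    (continuous_fst.comp continuous_subtype_val), fun g z hz h hg => ?_⟩
  refine ⟨⟨(g, A.invAct g z), (A.moment_invAct h).symm⟩, ⟨?_, hg⟩, rfl⟩
  change A.act g (A.invAct g z) _ ∈ C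
  rwa [A.act_invAct h]

end Actions

namespace GroupoidEquivalence

variable {G X H Y Z : Type*} [TopologicalSpace G] [TopologicalSpace X]
  [TopologicalSpace H] [TopologicalSpace Y] [TopologicalSpace Z] [LocallyCompactSpace Z]
  [T2Space Z] {𝒢 : TopGroupoid G X} {ℋ : TopGroupoid H Y} (E : GroupoidEquivalence 𝒢 ℋ Z)

theorem exists_act_eq_iff {y z : Z} : (∃ (h : H) (e : E.right.moment y = ℋ.r h),
    E.right.act y h e = z) ↔ E.left.moment y = E.left.moment z := by
  refine ⟨?_, E.left_injective y z⟩
  rintro ⟨h, e, rfl⟩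
  exact (E.left_moment_act y h e).symm

theorem continuousOn_arrow : ContinuousOn (fun a : Z × Z => E.right.arrow a.1 a.2)
    {a | E.left.moment a.1 = E.left.moment a.2} := by
  have := RightAction.continuousOn_arrow E.right_free E.right_proper
  simpa only [E.exists_act_eq_iff] using this

theorem arrow_spec {y z : Z} (h : E.left.moment y = E.left.moment z) :
    ∃ e : E.right.moment y = ℋ.r (E.right.arrow y z), E.right.act y (E.right.arrow y z) e = z :=
  E.right.arrow_spec (E.exists_act_eq_iff.2 h)

theorem arrow_act (z : Z) (h : H) (e : E.right.moment z = ℋ.r h) :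
    E.right.arrow z (E.right.act z h e) = h :=
  RightAction.arrow_act E.right_free z h e

/-- `[y, z] = k [y • k, z]`, where `[y, z]` is the arrow from `y` to `z`. -/
theorem arrow_eq_mul {y z : Z} {k : H} (e : E.right.moment y = ℋ.r k)
    (h : E.left.moment y = E.left.moment z) :
    ∃ h' : ℋ.s k = ℋ.r (E.right.arrow (E.right.act y k e) z),
      E.right.arrow y z = ℋ.mul k (E.right.arrow (E.right.act y k e) z) h' := by
  obtain ⟨e1, h1⟩ := E.arrow_spec (y := E.right.act y k e) (z := z)
    ((E.left_moment_act y k e).trans h)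
  have h' := (E.right.moment_act y k e).symm.trans e1
  refine ⟨h', ?_⟩
  conv_lhs => rw [← h1]
  rw [← E.right.act_mul y k _ e h', E.arrow_act]

theorem right_moment_invAct (g : G) (z : Z) :
    E.right.moment (E.left.invAct g z) = E.right.moment z := by
  unfold LeftAction.invAct
  split_ifs with h
  · exact E.right_moment_act _ _ _
  · rfl

theorem invAct_act {g : G} {z : Z} {k : H} (h : 𝒢.r g = E.left.moment z)
    (e : E.right.moment z = ℋ.r k) :
    E.left.invAct g (E.right.act z k e) =
      E.right.act (E.left.invAct g z) k ((E.right_moment_invAct g z).trans e) := by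
  rw [E.left.invAct_of_eq (h.trans (E.left_moment_act z k e).symm),
    ← E.act_comm (𝒢.inv g) z k ((𝒢.s_inv g).trans h) e]
  exact E.right.act_congr _ _ (E.left.invAct_of_eq h).symm rfl

variable [T2Space G] [LocallyCompactSpace G] [SecondCountableTopology G] [T2Space H]
  [LocallyCompactSpace H] [SecondCountableTopology H]

include E in
/-- The space of an equivalence of second countable groupoids is second countable. It is
`σ`-compact, because it is the saturation of a `σ`-compact set under the `σ`-compact space `H`.
Its diagonal is a `G_δ`, because it consists of the pairs in one fibre of the left moment map
whose arrow in `H` is a unit. -/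
theorem secondCountableTopology : SecondCountableTopology Z := by
  have := 𝒢.t2Space_base
  have := 𝒢.locallyCompactSpace_base
  have := 𝒢.secondCountableTopology_base
  have := ℋ.t2Space_base
  have hσ : SigmaCompactSpace Z := by
    choose N hN using fun z : Z => exists_compact_mem_nhds z
    have hcov : ∀ x, ∃ z, x ∈ interior (E.left.moment '' N z) := fun x => by
      obtain ⟨z, rfl⟩ := E.left_surjective x
      exact ⟨z, mem_interior_iff_mem_nhds.2 (E.left_open.image_mem_nhds (hN z).2)⟩
    obtain ⟨T, hT, hTcov⟩ := TopologicalSpace.isOpen_iUnion_countable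
      (fun z : Z => interior (E.left.moment '' N z)) fun z => isOpen_interior
    have hTc := hT.to_subtype
    refine isSigmaCompact_univ_iff.1 ?_
    have : (Set.univ : Set Z) = ⋃ i : T × ℕ, {w | ∃ z ∈ N i.1, ∃ h ∈ compactCovering H i.2,
        ∃ e : E.right.moment z = ℋ.r h, E.right.act z h e = w} := by
      refine (Set.eq_univ_of_forall fun w => ?_).symm
      have hw : E.left.moment w ∈ ⋃ i ∈ T, interior (E.left.moment '' N i) := by
        rw [hTcov]
        exact Set.mem_iUnion.2 (hcov _)
      simp only [Set.mem_iUnion] at hw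
      obtain ⟨z, hzT, hz⟩ := hw
      obtain ⟨y, hy, hyw⟩ := interior_subset hz
      obtain ⟨h, e, rfl⟩ := E.left_injective y w hyw
      obtain ⟨n, hn⟩ := exists_mem_compactCovering h
      exact Set.mem_iUnion.2 ⟨(⟨z, hzT⟩, n), y, hy, h, hn, e, rfl⟩
    rw [this]
    exact isSigmaCompact_iUnion_of_isCompact _ fun i =>
      E.right.isCompact_act (hN i.1).1 (isCompact_compactCovering H i.2)
  refine secondCountableTopology_of_sigmaCompact_of_isGδ_diagonal ?_
  let := TopologicalSpace.metrizableSpaceMetric X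
  let := TopologicalSpace.metrizableSpaceMetric H
  have hD : IsGδ {a : Z × Z | E.left.moment a.1 = E.left.moment a.2} := by
    have hd : IsGδ {x : X × X | x.1 = x.2} := (isClosed_eq continuous_fst continuous_snd).isGδ
    have hc : Continuous fun a : Z × Z => (E.left.moment a.1, E.left.moment a.2) :=
      (E.left.continuous_moment.comp continuous_fst).prodMk
        (E.left.continuous_moment.comp continuous_snd)
    exact hd.preimage hc
  obtain ⟨O, hO, hOu⟩ := isGδ_iff_eq_iInter_nat.1 ℋ.isClosedEmbedding_unit.isClosed_range.isGδ
  choose U hU hUO using fun n => continuousOn_iff'.1 E.continuousOn_arrow (O n) (hO n)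
  have hdiag : Set.diagonal Z =
      {a : Z × Z | E.left.moment a.1 = E.left.moment a.2} ∩ ⋂ n, U n := by
    ext ⟨y, z⟩
    constructor
    · intro hyz
      obtain rfl : y = z := hyz
      refine ⟨rfl, Set.mem_iInter.2 fun n => ?_⟩
      have h1 : E.right.arrow y y = ℋ.unit (E.right.moment y) := by
        have := E.arrow_act y (ℋ.unit (E.right.moment y)) (ℋ.r_unit _).symm
        rwa [E.right.act_unit] at this
      have h2 : (y, y) ∈ (fun a : Z × Z => E.right.arrow a.1 a.2) ⁻¹' O n ∩
          {a | E.left.moment a.1 = E.left.moment a.2} := by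
        refine ⟨?_, rfl⟩
        change E.right.arrow y y ∈ O n
        have : E.right.arrow y y ∈ ⋂ n, O n := hOu ▸ ⟨_, h1.symm⟩
        exact Set.mem_iInter.1 this n
      rw [hUO n] at h2
      exact h2.1
    · rintro ⟨hyz, hU'⟩
      have h1 : E.right.arrow y z ∈ Set.range ℋ.unit := by
        rw [hOu]
        refine Set.mem_iInter.2 fun n => ?_
        have h2 : (y, z) ∈ U n ∩ {a | E.left.moment a.1 = E.left.moment a.2} :=
          ⟨Set.mem_iInter.1 hU' n, hyz⟩
        rw [← hUO n] at h2
        exact h2.1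
      obtain ⟨u, hu⟩ := h1
      obtain ⟨e, he⟩ := E.arrow_spec hyz
      have hu' : u = E.right.moment y := by rw [e, ← hu, ℋ.r_unit]
      rw [Set.mem_diagonal_iff, ← he, E.right.act_congr e (ℋ.r_unit (E.right.moment y)).symm rfl
        (by rw [← hu, hu']), E.right.act_unit]
  rw [hdiag]
  exact hD.inter (.iInter fun n => (hU n).isGδ)

end GroupoidEquivalence

/-! ### Transfer of functionals from one groupoid to the other -/

/-- A function continuous on a closed set `D`, and vanishing on `D` off a compact set, agrees on
`D` with a continuous function with compact support. -/
theorem exists_hasCompactSupport_eqOn {W : Type*} [TopologicalSpace W] [T2Space W]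
    [LocallyCompactSpace W] [NormalSpace W] {D : Set W} (hD : IsClosed D) {f : W → ℝ}
    (hf : ContinuousOn f D) {S : Set W} (hS : IsCompact S) (hfS : ∀ w ∈ D, w ∉ S → f w = 0) :
    ∃ f' : W → ℝ, Continuous f' ∧ HasCompactSupport f' ∧ ∀ w ∈ D, f' w = f w := by
  obtain ⟨F, hF⟩ := ContinuousMap.exists_restrict_eq hD ⟨_, hf.domRestrict⟩
  obtain ⟨χ, hχ1, -, hχc, -⟩ := exists_continuous_one_zero_of_isCompact hS isClosed_empty
    (Set.disjoint_empty S)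
  refine ⟨fun w => F w * χ w, by fun_prop, hχc.mul_left, fun w hw => ?_⟩
  have h1 : F w = f w := DFunLike.congr_fun hF ⟨w, hw⟩
  by_cases hwS : w ∈ S
  · simp [h1, hχ1 hwS]
  · simp [h1, hfS w hw hwS]

namespace GroupoidEquivalence

variable {G X H Y Z : Type*}
  [TopologicalSpace G] [LocallyCompactSpace G] [T2Space G] [SecondCountableTopology G]
  [MeasurableSpace G] [BorelSpace G] [TopologicalSpace X] [T2Space X]
  [TopologicalSpace H] [TopologicalSpace Y] [T2Space Y]
  [TopologicalSpace Z] [LocallyCompactSpace Z] [T2Space Z] [SecondCountableTopology Z]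
  [MeasurableSpace Z] [BorelSpace Z]
  {𝒢 : TopGroupoid G X} {ℋ : TopGroupoid H Y}
  (E : GroupoidEquivalence 𝒢 ℋ Z) (lam : HaarSystem 𝒢) (β : X → Measure Z)

/-- The integral of a function on `H` over the arrows that start at the right moment of `y`,
identified by `w = y • h` with the points `w` of the orbit of `y`, against the given measure on
this orbit. -/
noncomputable def orbitIntegral (f : H → ℝ) (y : Z) : ℝ :=
  ∫ w, f (E.right.arrow y w) ∂(β (E.left.moment y))

/-- The integral of `E.orbitIntegral β f` over the `𝒢`-orbit of `z`, against the image of the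
Haar system of `𝒢`. As a function of `f` it is a positive functional, which turns out to be
left invariant whatever `β` is. -/
noncomputable def transfer (f : H → ℝ) (z : Z) : ℝ :=
  ∫ g, E.orbitIntegral β f (E.left.invAct g z) ∂(lam.measure (E.left.moment z))

variable {β} {K : Set Z} (hβ : IsContinuousSystem E.left.moment β) (hK : IsCompact K)
  (hβK : ∀ x, β x Kᶜ = 0)

theorem orbitIntegral_congr {f f' : H → ℝ} {y : Z}
    (hβ : IsContinuousSystem E.left.moment β)
    (h : ∀ k, ℋ.r k = E.right.moment y → f k = f' k) :
    E.orbitIntegral β f y = E.orbitIntegral β f' y := by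
  refine integral_congr_ae ?_
  have hae : ∀ᵐ w ∂(β (E.left.moment y)), E.left.moment w = E.left.moment y :=
    ae_iff.2 (hβ.fibre _)
  filter_upwards [hae] with w hw
  obtain ⟨e, -⟩ := E.arrow_spec hw.symm
  exact h _ e.symm

theorem orbitIntegral_nonneg {f : H → ℝ} (h : ∀ k, 0 ≤ f k) (y : Z) :
    0 ≤ E.orbitIntegral β f y :=
  integral_nonneg fun _ => h _

section
include hβ hK hβK

theorem integrable_arrow {f : H → ℝ} (hf : Continuous f) (y : Z) :
    Integrable (fun w => f (E.right.arrow y w)) (β (E.left.moment y)) := by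
  refine hβ.integrable_param E.left.continuous_moment E.left.continuous_moment
    (F := fun y w => f (E.right.arrow y w)) (hf.comp_continuousOn E.continuousOn_arrow)
    (fun y => ⟨K, hK, .of_forall fun y' => ?_⟩) y
  filter_upwards [show ∀ᵐ w ∂(β (E.left.moment y')), w ∈ K from hβK _] with w hw hw'
  exact absurd hw hw'

theorem continuous_orbitIntegral {f : H → ℝ} (hf : Continuous f) :
    Continuous (E.orbitIntegral β f) := by
  refine hβ.continuous_integral_param E.left.continuous_moment E.left.continuous_moment
    (F := fun y w => f (E.right.arrow y w)) (hf.comp_continuousOn E.continuousOn_arrow)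
    (fun y => ⟨K, hK, .of_forall fun y' => ?_⟩)
  filter_upwards [show ∀ᵐ w ∂(β (E.left.moment y')), w ∈ K from hβK _] with w hw hw'
  exact absurd hw hw'

theorem exists_isCompact_orbitIntegral {f : H → ℝ} (hf : HasCompactSupport f) :
    ∃ S : Set Z, IsCompact S ∧ ∀ y ∉ S, E.orbitIntegral β f y = 0 := by
  refine ⟨_, E.right.isCompact_act hK (hf.isCompact.image ℋ.continuous_inv), fun y hy => ?_⟩
  refine integral_eq_zero_of_ae ?_
  have hae : ∀ᵐ w ∂(β (E.left.moment y)), E.left.moment w = E.left.moment y :=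
    ae_iff.2 (hβ.fibre _)
  filter_upwards [show ∀ᵐ w ∂(β (E.left.moment y)), w ∈ K from hβK _, hae] with w hwK hw
  by_contra hne
  obtain ⟨e, he⟩ := E.arrow_spec hw.symm
  have e' : E.right.moment w = ℋ.r (ℋ.inv (E.right.arrow y w)) := by
    rw [ℋ.r_inv, ← E.right.moment_act y _ e, he]
  exact hy ⟨w, hwK, _, ⟨_, subset_tsupport f hne, rfl⟩, e', E.right.act_inv e he e'⟩

/-- Locally uniformly in `z`, the integrand of `transfer` has compact support in `g`, since the left
action is proper. -/
theorem orbitIntegral_param {f : H → ℝ} (hf : HasCompactSupport f) (z₀ : Z) :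
    ∃ S : Set G, IsCompact S ∧ ∀ᶠ z in 𝓝 z₀, ∀ᵐ g ∂(lam.measure (E.left.moment z)),
      g ∉ S → E.orbitIntegral β f (E.left.invAct g z) = 0 := by
  obtain ⟨D, hD, hfD⟩ := E.exists_isCompact_orbitIntegral hβ hK hβK hf
  obtain ⟨C, hC, hCz⟩ := exists_compact_mem_nhds z₀
  obtain ⟨S, hS, hS'⟩ := E.left_proper.exists_isCompact hC hD
  refine ⟨S, hS, ?_⟩
  filter_upwards [hCz] with z hz
  have hae : ∀ᵐ g ∂(lam.measure (E.left.moment z)), 𝒢.r g = E.left.moment z :=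
    ae_iff.2 (lam.isContinuousSystem.fibre _)
  filter_upwards [hae] with g hg hgS
  exact hfD _ fun h => hgS (hS' g z hz hg h)

theorem continuousOn_orbitIntegral_invAct {f : H → ℝ} (hf : Continuous f) :
    ContinuousOn (fun a : Z × G => E.orbitIntegral β f (E.left.invAct a.2 a.1))
      {a | E.left.moment a.1 = 𝒢.r a.2} :=
  (E.continuous_orbitIntegral hβ hK hβK hf).comp_continuousOn E.left.continuousOn_invAct

theorem integrable_orbitIntegral {f : H → ℝ} (hf : Continuous f) (hf' : HasCompactSupport f)
    (z : Z) : Integrable (fun g => E.orbitIntegral β f (E.left.invAct g z))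
      (lam.measure (E.left.moment z)) :=
  lam.isContinuousSystem.integrable_param 𝒢.continuous_r E.left.continuous_moment
    (E.continuousOn_orbitIntegral_invAct hβ hK hβK hf)
    (E.orbitIntegral_param lam hβ hK hβK hf') z

theorem continuous_transfer {f : H → ℝ} (hf : Continuous f) (hf' : HasCompactSupport f) :
    Continuous (E.transfer lam β f) :=
  lam.isContinuousSystem.continuous_integral_param 𝒢.continuous_r E.left.continuous_moment
    (E.continuousOn_orbitIntegral_invAct hβ hK hβK hf)
    (E.orbitIntegral_param lam hβ hK hβK hf')

theorem transfer_add {f f' : H → ℝ} (hf : Continuous f) (hfc : HasCompactSupport f)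
    (hf' : Continuous f') (hfc' : HasCompactSupport f') (z : Z) :
    E.transfer lam β (f + f') z = E.transfer lam β f z + E.transfer lam β f' z := by
  have h : ∀ y, E.orbitIntegral β (f + f') y =
      E.orbitIntegral β f y + E.orbitIntegral β f' y := fun y =>
    integral_add (E.integrable_arrow hβ hK hβK hf y) (E.integrable_arrow hβ hK hβK hf' y)
  simp only [transfer, h]
  exact integral_add (E.integrable_orbitIntegral lam hβ hK hβK hf hfc z)
    (E.integrable_orbitIntegral lam hβ hK hβK hf' hfc' z)

/-- The transferred functionals are constant on `𝒢`-orbits, by left invariance of the Haar system. -/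
theorem transfer_left_act {f : H → ℝ} (hf : Continuous f) {k : G} {z : Z}
    (hk : 𝒢.s k = E.left.moment z) :
    E.transfer lam β f (E.left.act k z hk) = E.transfer lam β f z := by
  unfold transfer
  have hc : ContinuousOn (fun g => E.orbitIntegral β f (E.left.invAct g (E.left.act k z hk)))
      {g | 𝒢.r g = 𝒢.r k} := by
    refine (E.continuousOn_orbitIntegral_invAct hβ hK hβK hf).comp
      (f := fun g => (E.left.act k z hk, g)) (by fun_prop) fun g hg => ?_
    exact (E.left.moment_act k z hk).trans hg.symm
  rw [E.left.moment_act, ← lam.integral_leftMul k hc, hk]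
  refine integral_congr_ae ?_
  have hae : ∀ᵐ g ∂(lam.measure (E.left.moment z)), 𝒢.r g = E.left.moment z :=
    ae_iff.2 (lam.isContinuousSystem.fibre _)
  filter_upwards [hae] with y hy
  rw [E.left.invAct_leftMul hk (hk.trans hy.symm)]

theorem transfer_eq_of_right_moment_eq {f : H → ℝ} (hf : Continuous f) {z z' : Z}
    (h : E.right.moment z = E.right.moment z') :
    E.transfer lam β f z = E.transfer lam β f z' := by
  obtain ⟨k, hk, rfl⟩ := E.right_injective z z' h
  exact (E.transfer_left_act lam hβ hK hβK hf hk).symm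

/-- The transferred functional at `z` is positive on `f` if the orbit of `z` has positive measure,
and `f` is positive on the arrows from `z` to the points of `K`. -/
theorem transfer_pos {f : H → ℝ} (hf : Continuous f) (hf' : HasCompactSupport f)
    (h0 : ∀ k, 0 ≤ f k) {z : Z} (hne : β (E.left.moment z) ≠ 0)
    (hpos : ∀ w ∈ K, E.left.moment z = E.left.moment w → 0 < f (E.right.arrow z w)) :
    0 < E.transfer lam β f z := by
  have h1 : 0 < E.orbitIntegral β f z := by
    rw [orbitIntegral, integral_pos_iff_support_of_nonneg (fun w => h0 _)
      (E.integrable_arrow hβ hK hβK hf z), pos_iff_ne_zero]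
    intro hz
    refine hne (Measure.measure_univ_eq_zero.1 (measure_mono_null ?_
      (measure_union_null (measure_union_null hz (hβK (E.left.moment z)))
        (hβ.fibre (E.left.moment z)))))
    intro w _
    by_cases hwK : w ∈ K
    · by_cases hw : E.left.moment z = E.left.moment w
      · exact .inl (.inl (hpos w hwK hw).ne')
      · exact .inr fun h => hw h.symm
    · exact .inl (.inr hwK)
  have hsupp : 𝒢.unit (E.left.moment z) ∈ (lam.measure (E.left.moment z)).support := by
    rw [lam.support_eq]
    exact 𝒢.r_unit _
  refine integral_pos_of_mem_support (fun g => E.orbitIntegral_nonneg h0 _)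
    (E.integrable_orbitIntegral lam hβ hK hβK hf hf' z) hsupp
    (lam.isContinuousSystem.fibre (E.left.moment z)) ?_
  have hc : ContinuousOn (fun g => E.orbitIntegral β f (E.left.invAct g z))
      {g | 𝒢.r g = E.left.moment z} :=
    (E.continuousOn_orbitIntegral_invAct hβ hK hβK hf).comp
      (f := fun g => (z, g)) (by fun_prop) fun g hg => Eq.symm hg
  have hu := hc (𝒢.unit (E.left.moment z)) (𝒢.r_unit _)
  refine hu.eventually_const_lt ?_
  change 0 < E.orbitIntegral β f (E.left.invAct (𝒢.unit (E.left.moment z)) z)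
  rwa [E.left.invAct_unit]

end

theorem transfer_smul (c : ℝ) (f : H → ℝ) (z : Z) :
    E.transfer lam β (c • f) z = c * E.transfer lam β f z := by
  have h : ∀ y, E.orbitIntegral β (c • f) y = c * E.orbitIntegral β f y := fun y =>
    integral_const_mul c _
  simp only [transfer, h]
  exact integral_const_mul c _

theorem transfer_nonneg {f : H → ℝ} (h : ∀ k, 0 ≤ f k) (z : Z) : 0 ≤ E.transfer lam β f z :=
  integral_nonneg fun _ => E.orbitIntegral_nonneg h _

section
include hβ

theorem transfer_congr {f f' : H → ℝ} {z : Z}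
    (h : ∀ k, ℋ.r k = E.right.moment z → f k = f' k) :
    E.transfer lam β f z = E.transfer lam β f' z := by
  unfold transfer
  congr 1
  ext g
  exact E.orbitIntegral_congr hβ fun k hk => h k (hk.trans (E.right_moment_invAct g z))

theorem orbitIntegral_right_act {f f' : H → ℝ} {k : H} {y : Z} (e : E.right.moment y = ℋ.r k)
    (h : ∀ a (ha : ℋ.s k = ℋ.r a), f' a = f (ℋ.mul k a ha)) :
    E.orbitIntegral β f' (E.right.act y k e) = E.orbitIntegral β f y := by
  unfold orbitIntegral
  rw [E.left_moment_act]
  refine integral_congr_ae ?_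
  have hae : ∀ᵐ w ∂(β (E.left.moment y)), E.left.moment w = E.left.moment y :=
    ae_iff.2 (hβ.fibre _)
  filter_upwards [hae] with w hw
  obtain ⟨h', hh⟩ := E.arrow_eq_mul e hw.symm
  rw [hh, h _ h']

/-- Left invariance of the transferred functionals. -/
theorem transfer_right_act {f f' : H → ℝ} {k : H} {z : Z} (e : E.right.moment z = ℋ.r k)
    (h : ∀ a (ha : ℋ.s k = ℋ.r a), f' a = f (ℋ.mul k a ha)) :
    E.transfer lam β f' (E.right.act z k e) = E.transfer lam β f z := by
  unfold transfer
  rw [E.left_moment_act]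
  refine integral_congr_ae ?_
  have hae : ∀ᵐ g ∂(lam.measure (E.left.moment z)), 𝒢.r g = E.left.moment z :=
    ae_iff.2 (lam.isContinuousSystem.fibre _)
  filter_upwards [hae] with g hg
  rw [E.invAct_act hg e]
  exact E.orbitIntegral_right_act hβ _ h

end

end GroupoidEquivalence

/-! ### Invariant families of functionals and Haar systems -/

section InvariantFunctional

variable {H Y : Type*} [TopologicalSpace H] [LocallyCompactSpace H] [T2Space H]
  [SecondCountableTopology H] [TopologicalSpace Y] [T2Space Y]

/-- A family of positive functionals `L v` on `C_c(H)`, one for each unit `v`, that is concentrated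
on the fibres of the range map, continuous, and left invariant. The functionals are given on all
functions `H → ℝ`, but additivity, continuity and invariance concern `C_c(H)` only. In contrast to
the functionals of a Haar system they need not have full support. -/
structure IsInvariantFunctional (ℋ : TopGroupoid H Y) (L : Y → (H → ℝ) → ℝ) : Prop where
  add : ∀ v (f f' : H → ℝ), Continuous f → HasCompactSupport f → Continuous f' →
    HasCompactSupport f' → L v (f + f') = L v f + L v f'
  smul : ∀ v (c : ℝ) (f : H → ℝ), L v (c • f) = c * L v f
  nonneg : ∀ v (f : H → ℝ), (∀ h, 0 ≤ f h) → 0 ≤ L v f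
  continuous : ∀ f : H → ℝ, Continuous f → HasCompactSupport f → Continuous fun v => L v f
  congr : ∀ v (f f' : H → ℝ), (∀ h, ℋ.r h = v → f h = f' h) → L v f = L v f'
  invariant : ∀ k (f f' : H → ℝ), Continuous f → HasCompactSupport f → Continuous f' →
    HasCompactSupport f' → (∀ a (ha : ℋ.s k = ℋ.r a), f' a = f (ℋ.mul k a ha)) →
    L (ℋ.s k) f' = L (ℋ.r k) f

namespace IsInvariantFunctional

variable {ℋ : TopGroupoid H Y} {L : Y → (H → ℝ) → ℝ} (hL : IsInvariantFunctional ℋ L)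
include hL

theorem map_zero (v : Y) : L v 0 = 0 := by
  simpa using hL.smul v 0 0

theorem abs_map_le {v : Y} {f χ : H → ℝ} (hf : Continuous f) (hf' : HasCompactSupport f)
    (hχ : Continuous χ) (hχ' : HasCompactSupport χ) {A : ℝ} (h : ∀ x, |f x| ≤ A * χ x) :
    |L v f| ≤ A * L v χ := by
  have key : ∀ g : H → ℝ, Continuous g → HasCompactSupport g → (∀ x, g x ≤ A * χ x) →
      L v g ≤ A * L v χ := by
    intro g hg hg' hgA
    have h1 : HasCompactSupport (A • χ) := hχ'.mono (Function.support_const_smul_subset A χ)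
    have hng : HasCompactSupport ((-1 : ℝ) • g) := 
      hg'.mono (Function.support_const_smul_subset _ g)
    have h2 := hL.add v (A • χ) ((-1 : ℝ) • g) (hχ.const_smul A) h1 (hg.const_smul _) hng
    have h3 := hL.nonneg v (A • χ + (-1 : ℝ) • g) fun x => by
      simp only [Pi.add_apply, Pi.smul_apply, smul_eq_mul]
      linarith [hgA x]
    rw [h2, hL.smul, hL.smul] at h3
    linarith
  have hng : HasCompactSupport ((-1 : ℝ) • f) := 
    hf'.mono (Function.support_const_smul_subset _ f)
  have h1 := key f hf hf' fun x => (abs_le.1 (h x)).2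
  have h2 := key ((-1 : ℝ) • f) (hf.const_smul _) hng fun x => by
    simp only [Pi.smul_apply, smul_eq_mul]
    linarith [(abs_le.1 (h x)).1]
  rw [hL.smul] at h2
  exact abs_le.2 ⟨by linarith, h1⟩

/-- The function `v ↦ L v f` has compact support, and so is bounded above. -/
theorem exists_bound {f : H → ℝ} (hf : Continuous f) (hf' : HasCompactSupport f) :
    ∃ C, 0 ≤ C ∧ ∀ v, L v f ≤ C := by
  obtain ⟨C, hC⟩ := ((hf'.isCompact.image ℋ.continuous_r).image
    (hL.continuous f hf hf')).bddAbove
  refine ⟨max C 0, le_max_right _ _, fun v => ?_⟩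
  by_cases hv : v ∈ ℋ.r '' tsupport f
  · exact (hC ⟨v, hv, rfl⟩).trans (le_max_left _ _)
  · rw [hL.congr v f 0 fun h hh => image_eq_zero_of_notMem_tsupport fun hmem => hv ⟨h, hmem, hh⟩,
      hL.map_zero]
    exact le_max_right _ _

/-- An invariant family with full support comes from a Haar system. -/
theorem nonempty_haarSystem [MeasurableSpace H] [BorelSpace H]
    (hpos : ∀ (h : H) (f : H → ℝ), Continuous f → HasCompactSupport f → (∀ k, 0 ≤ f k) →
      0 < f h → 0 < L (ℋ.r h) f) : Nonempty (HaarSystem ℋ) := by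
  choose μ hreg hμ using fun v => exists_regular_measure_of_functional (L v)
    (hL.add v) (fun c f _ _ => hL.smul v c f) (fun f _ _ h => hL.nonneg v f h)
  have hclosed : ∀ v, IsClosed {x | ℋ.r x = v} := fun v =>
    isClosed_eq ℋ.continuous_r continuous_const
  have hfib : ∀ v, μ v {x | ℋ.r x = v}ᶜ = 0 := by
    intro v
    refine measure_eq_zero_of_integral_eq_zero (hclosed v).isOpen_compl fun f hf hf' _ hf0 => ?_
    rw [hμ v f hf hf', hL.congr v f 0 fun h hh => hf0 h fun hc => hc hh, hL.map_zero]
  refine ⟨⟨μ, hreg, fun v => ?_, fun f hf hf' => ?_, fun k A hA => ?_⟩⟩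
  · refine subset_antisymm (Measure.support_subset_of_isClosed (hclosed v) (hfib v)) ?_
    rintro h rfl
    rw [Measure.support_eq_forall_isOpen]
    intro U hhU hU
    rw [pos_iff_ne_zero]
    intro h0
    obtain ⟨f, hf1, hf0, hfc, hf⟩ := exists_continuous_one_zero_of_isCompact
      (isCompact_singleton (x := h)) hU.isClosed_compl
      (Set.disjoint_compl_right_iff_subset.2 (Set.singleton_subset_iff.2 hhU))
    have h1 := hpos h f f.continuous hfc (fun k => (hf k).1) (by rw [hf1 rfl]; exact one_pos)
    rw [← hμ _ f f.continuous hfc, integral_eq_zero_of_ae] at h1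
    · exact h1.false
    · refine ae_iff.2 (measure_mono_null (fun k hk => ?_) h0)
      by_contra hkU
      exact hk (hf0 hkU)
  · have hre : Continuous fun v => ∫ x, RCLike.re (f x) ∂(μ v) := by
      have hc : Continuous fun x => RCLike.re (f x) := by fun_prop
      have hs : HasCompactSupport fun x => RCLike.re (f x) :=
        hf'.comp_left (g := fun z : ℂ => RCLike.re z) (by simp)
      simpa only [hμ _ _ hc hs] using hL.continuous _ hc hs
    have him : Continuous fun v => ∫ x, RCLike.im (f x) ∂(μ v) := by
      have hc : Continuous fun x => RCLike.im (f x) := by fun_prop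
      have hs : HasCompactSupport fun x => RCLike.im (f x) :=
        hf'.comp_left (g := fun z : ℂ => RCLike.im z) (by simp)
      simpa only [hμ _ _ hc hs] using hL.continuous _ hc hs
    have heq : ∀ v, ∫ x, f x ∂(μ v) = ((∫ x, RCLike.re (f x) ∂(μ v) : ℝ) : ℂ) +
        ((∫ x, RCLike.im (f x) ∂(μ v) : ℝ) : ℂ) * Complex.I := fun v =>
      (integral_re_add_im (hf.integrable_of_hasCompactSupport hf')).symm
    simp only [heq]
    fun_prop
  · -- the translate of `μ (s k)` is a Radon measure with the same integrals as `μ (r k)`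
    rw [← ℋ.map_leftMul_apply k (hfib _) hA]
    have hmeas := ℋ.aemeasurable_leftMul k (hfib (ℋ.s k))
    have hfin : IsFiniteMeasureOnCompacts ((μ (ℋ.s k)).map (ℋ.leftMul k)) := by
      refine ⟨fun {C} hC => ?_⟩
      rw [ℋ.map_leftMul_apply k (hfib _) hC.isClosed.measurableSet]
      obtain ⟨S, hS, hS'⟩ := ℋ.isCompact_leftMul_preimage k hC
      refine (measure_mono ?_).trans_lt hS.measure_lt_top
      rintro y ⟨hy, hyC⟩
      exact hS' y hy (by rwa [ℋ.leftMul_of_eq hy])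
    let := TopologicalSpace.metrizableSpaceMetric H
    have hreg' : ((μ (ℋ.s k)).map (ℋ.leftMul k)).Regular := inferInstance
    congr 1
    refine Measure.ext_of_integral_eq_on_compactlySupported fun f => ?_
    have hfc : Continuous (f : H → ℝ) := f.continuous
    rw [integral_map hmeas hfc.aestronglyMeasurable]
    obtain ⟨S, hS, hS'⟩ := ℋ.isCompact_leftMul_preimage k f.hasCompactSupport.isCompact
    obtain ⟨f', hf', hfc', hff'⟩ := exists_hasCompactSupport_eqOn (hclosed (ℋ.s k))
      (hfc.comp_continuousOn (ℋ.continuousOn_leftMul k)) hS fun y hy hyS =>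
        image_eq_zero_of_notMem_tsupport (f := f) fun h => hyS (hS' y (Eq.symm hy) h)
    have hae : ∀ᵐ y ∂(μ (ℋ.s k)), ℋ.r y = ℋ.s k := ae_iff.2 (hfib _)
    calc ∫ y, f (ℋ.leftMul k y) ∂(μ (ℋ.s k)) = ∫ y, f' y ∂(μ (ℋ.s k)) := by
          refine integral_congr_ae ?_
          filter_upwards [hae] with y hy
          exact (hff' y hy).symm
      _ = L (ℋ.s k) f' := hμ _ f' hf' hfc'
      _ = L (ℋ.r k) f := by
          refine hL.invariant k f f' f.continuous f.hasCompactSupport hf' hfc' fun a ha => ?_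
          rw [hff' a ha.symm, Function.comp_apply, ℋ.leftMul_of_eq ha]
      _ = ∫ y, f y ∂(μ (ℋ.r k)) := (hμ _ f f.continuous f.hasCompactSupport).symm

end IsInvariantFunctional

/-- A sequence of invariant families can be summed after multiplication by small constants. The
constants are chosen by a diagonal argument along a compact exhaustion of `H`. -/
theorem exists_isInvariantFunctional_tsum {ℋ : TopGroupoid H Y} {L : ℕ → Y → (H → ℝ) → ℝ}
    (hL : ∀ k, IsInvariantFunctional ℋ (L k)) :
    ∃ c : ℕ → ℝ, (∀ k, 0 < c k) ∧
      (∀ v f, Continuous f → HasCompactSupport f → Summable fun k => c k * L k v f) ∧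
      IsInvariantFunctional ℋ fun v f => ∑' k, c k * L k v f := by
  let E := CompactExhaustion.choice H
  choose χ hχ1 _ hχc hχ using fun n => exists_continuous_one_zero_of_isCompact (E.isCompact n)
    isClosed_empty (Set.disjoint_empty (E n))
  choose C hC0 hC using fun k n => (hL k).exists_bound (χ n).continuous (hχc n)
  have hden : ∀ k, 0 < 1 + ∑ n ∈ Finset.range (k + 1), C k n := fun k => by
    have := Finset.sum_nonneg fun n (_ : n ∈ Finset.range (k + 1)) => hC0 k n
    linarith
  let c : ℕ → ℝ := fun k => (1 / 2) ^ k / (1 + ∑ n ∈ Finset.range (k + 1), C k n)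
  have hc : ∀ k, 0 < c k := fun k => div_pos (by positivity) (hden k)
  have hcC : ∀ n k, n ≤ k → c k * C k n ≤ (1 / 2) ^ k := fun n k hnk => by
    have h1 : C k n ≤ 1 + ∑ n ∈ Finset.range (k + 1), C k n := by
      have := Finset.single_le_sum (f := C k) (fun n _ => hC0 k n)
        (Finset.mem_range.2 (Nat.lt_succ_of_le hnk))
      linarith
    rw [div_mul_eq_mul_div, div_le_iff₀ (hden k)]
    exact mul_le_mul_of_nonneg_left h1 (by positivity)
  have hbound : ∀ f : H → ℝ, Continuous f → HasCompactSupport f →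
      ∃ u : ℕ → ℝ, Summable u ∧ ∀ k v, ‖c k * L k v f‖ ≤ u k := by
    intro f hf hf'
    obtain ⟨n, hn⟩ := E.exists_superset_of_isCompact hf'.isCompact
    obtain ⟨A, hA⟩ := hf'.exists_bound_of_continuous hf
    have hA' : ∀ x, |f x| ≤ max A 0 * χ n x := fun x => by
      by_cases hx : x ∈ tsupport f
      · rw [hχ1 n (hn hx)]
        simpa using Or.inl (hA x)
      · rw [image_eq_zero_of_notMem_tsupport hx, abs_zero]
        exact mul_nonneg (le_max_right _ _) (hχ n x).1
    refine ⟨fun k => max A 0 * (c k * C k n), Summable.mul_left _ ?_, fun k v => ?_⟩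
    · refine Summable.of_norm_bounded_eventually_nat summable_geometric_two ?_
      filter_upwards [Filter.eventually_ge_atTop n] with k hk
      rw [Real.norm_of_nonneg (mul_nonneg (hc k).le (hC0 k n))]
      exact hcC n k hk
    · rw [norm_mul, Real.norm_of_nonneg (hc k).le, Real.norm_eq_abs]
      calc c k * |L k v f| ≤ c k * (max A 0 * C k n) := by
            refine mul_le_mul_of_nonneg_left ?_ (hc k).le
            exact ((hL k).abs_map_le hf hf' (χ n).continuous (hχc n) hA').trans
              (mul_le_mul_of_nonneg_left (hC k n v) (le_max_right _ _))
        _ = max A 0 * (c k * C k n) := by ring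
  have hsum : ∀ v f, Continuous f → HasCompactSupport f → Summable fun k => c k * L k v f := by
    intro v f hf hf'
    obtain ⟨u, hu, huL⟩ := hbound f hf hf'
    exact hu.of_norm_bounded fun k => huL k v
  refine ⟨c, hc, hsum, ⟨fun v f f' hf hfc hf' hfc' => ?_, fun v a f => ?_, fun v f h => ?_,
    fun f hf hf' => ?_, fun v f f' h => ?_, fun k f f' hf hfc hf' hfc' h => ?_⟩⟩
  · rw [← (hsum v f hf hfc).tsum_add (hsum v f' hf' hfc')]
    simp only [(hL _).add v f f' hf hfc hf' hfc', mul_add]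
  · rw [← tsum_mul_left]
    simp only [(hL _).smul, mul_left_comm]
  · exact tsum_nonneg fun k => mul_nonneg (hc k).le ((hL k).nonneg v f h)
  · obtain ⟨u, hu, huL⟩ := hbound f hf hf'
    exact continuous_tsum (fun k => continuous_const.mul ((hL k).continuous f hf hf')) hu huL
  · simp only [(hL _).congr v f f' h]
  · simp only [(hL _).invariant k f f' hf hfc hf' hfc' h]

end InvariantFunctional

section

variable {G X H Y Z : Type*}
  [TopologicalSpace G] [LocallyCompactSpace G] [T2Space G] [SecondCountableTopology G]
  [MeasurableSpace G] [BorelSpace G] [TopologicalSpace X] [T2Space X]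
  [TopologicalSpace H] [TopologicalSpace Y] [T2Space Y]
  [TopologicalSpace Z] [LocallyCompactSpace Z] [T2Space Z] [SecondCountableTopology Z]
  [MeasurableSpace Z] [BorelSpace Z]
  {𝒢 : TopGroupoid G X} {ℋ : TopGroupoid H Y}

/-- The transferred functionals descend along the right moment map. -/
theorem GroupoidEquivalence.isInvariantFunctional_transfer (E : GroupoidEquivalence 𝒢 ℋ Z)
    (lam : HaarSystem 𝒢) {β : X → Measure Z} (hβ : IsContinuousSystem E.left.moment β)
    {K : Set Z} (hK : IsCompact K) (hβK : ∀ x, β x Kᶜ = 0) :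
    IsInvariantFunctional ℋ fun v f =>
      E.transfer lam β f (Function.surjInv E.right_surjective v) := by
  have hz : ∀ v, E.right.moment (Function.surjInv E.right_surjective v) = v :=
    Function.surjInv_eq E.right_surjective
  refine ⟨fun v f f' hf hfc hf' hfc' => E.transfer_add lam hβ hK hβK hf hfc hf' hfc' _,
    fun v c f => E.transfer_smul lam c f _, fun v f h => E.transfer_nonneg lam h _,
    fun f hf hf' => ?_,
    fun v f f' h => E.transfer_congr lam hβ fun k hk => h k (hk.trans (hz v)),
    fun k f f' hf _ hf' _ h => ?_⟩
  · have hq := E.right_open.isQuotientMap E.right.continuous_moment E.right_surjective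
    refine hq.continuous_iff.2 ((E.continuous_transfer lam hβ hK hβK hf hf').congr fun z => ?_)
    exact E.transfer_eq_of_right_moment_eq lam hβ hK hβK hf (hz _).symm
  · rw [← E.transfer_right_act lam hβ (hz (ℋ.r k)) h]
    refine E.transfer_eq_of_right_moment_eq lam hβ hK hβK hf' ?_
    rw [hz, E.right.moment_act]

end

theorem theorem1 {G X H Y Z : Type*}
    [TopologicalSpace G] [LocallyCompactSpace G] [T2Space G] [SecondCountableTopology G]
    [MeasurableSpace G] [BorelSpace G] [TopologicalSpace X]
    [TopologicalSpace H] [LocallyCompactSpace H] [T2Space H] [SecondCountableTopology H]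
    [MeasurableSpace H] [BorelSpace H] [TopologicalSpace Y]
    [TopologicalSpace Z] [LocallyCompactSpace Z] [T2Space Z]
    (𝒢 : TopGroupoid G X) (ℋ : TopGroupoid H Y)
    (E : GroupoidEquivalence 𝒢 ℋ Z) (lam : HaarSystem 𝒢) :
    Nonempty (HaarSystem ℋ) := by
  have := 𝒢.t2Space_base
  have := 𝒢.locallyCompactSpace_base
  have := 𝒢.secondCountableTopology_base
  have := ℋ.t2Space_base
  have hX : PerfectlyNormalSpace X := by
    let := TopologicalSpace.metrizableSpaceMetric X
    infer_instance
  have := E.secondCountableTopology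
  borelize Z
  rcases isEmpty_or_nonempty Z with hZ | hZ
  · have hY : IsEmpty Y := ⟨fun v => hZ.elim (E.right_surjective v).choose⟩
    exact ⟨⟨fun v => hY.elim v, fun v => hY.elim v, fun v => hY.elim v,
      fun _ _ _ => continuous_of_const fun v => hY.elim v, fun x => hY.elim (ℋ.r x)⟩⟩
  -- one family `β n` for each set of a countable base; their transfers are added up
  obtain ⟨V, hVo, hVc, hV⟩ := exists_seq_isOpen_isCompact_closure Z
  choose β hβ hβV hβne using fun n =>
    exists_isContinuousSystem E.left.continuous_moment E.left_open (hVo n) (hVc n)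
  have hL := fun n => E.isInvariantFunctional_transfer lam (hβ n) (hVc n) (hβV n)
  obtain ⟨c, hc, hsum, hinv⟩ := exists_isInvariantFunctional_tsum hL
  refine hinv.nonempty_haarSystem fun h f hf hf' h0 hfh => ?_
  set z := Function.surjInv E.right_surjective (ℋ.r h) with hz
  have e : E.right.moment z = ℋ.r h := Function.surjInv_eq E.right_surjective _
  have hcont : ContinuousOn (fun w => f (E.right.arrow z w))
      {w | E.left.moment z = E.left.moment w} :=
    (hf.comp_continuousOn E.continuousOn_arrow).comp (f := fun w => (z, w)) (by fun_prop)
      fun w hw => hw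
  have hzw : E.left.moment z = E.left.moment (E.right.act z h e) := (E.left_moment_act z h e).symm
  have hev : ∀ᶠ w in 𝓝 (E.right.act z h e),
      E.left.moment z = E.left.moment w → 0 < f (E.right.arrow z w) := by
    refine eventually_nhdsWithin_iff.1 ((hcont _ hzw).eventually_const_lt ?_)
    change 0 < f (E.right.arrow z (E.right.act z h e))
    rwa [E.arrow_act]
  -- `f` is positive on the arrows from `z` to the points of a small basic set around `z • h`
  obtain ⟨n, hwV, hVsub⟩ := hV _ _ hev
  exact (hsum _ f hf hf').tsum_pos (fun n => mul_nonneg (hc n).le ((hL n).nonneg _ f h0)) n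
    (mul_pos (hc n) (E.transfer_pos lam (hβ n) (hVc n) (hβV n) hf hf' h0
      (hzw ▸ hβne n _ hwV) fun w hw hw' => hVsub hw hw'))
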